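/- Let $\mathcal Q_{\mathbb N}$ be the universal (unital) C*-algebra generated by isometries $s_n$, $n\in\{1,2,3,\dots\}$, with range projections $e_n=s_ns_n^*$, and by a unitary $u$, subject to the relations $$s_ns_m=s_{nm},\qquad s_nu=u^ns_n,\qquad \sum_{k=0}^{n-1}u^ke_nu^{-k}=1\qquad(n,m\ge 1).$$ That is, $\mathcal Q_{\mathbb N}$ is generated as a C*-algebra by elements $s_n,u$ satisfying these relations, and whenever isometries $t_n$ and a unitary $w$ in a unital C*-algebra $B$ satisfy the same relations, there is a unique unital $*$-homomorphism $\mathcal Q_{\mathbb N}\to B$ with $s_n\mapsto t_n$ and $u\mapsto w$. Then $\mathcal Q_{\mathbb N}$ is simple and purely infinite. Here simple means: $\mathcal Q_{\mathbb N}\neq 0$, and $0$ and $\mathcal Q_{\mathbb N}$ are its only closed two-sided ideals. Purely infinite means: every nonzero hereditary C*-subalgebra of $\mathcal Q_{\mathbb N}$ contains an infinite projection, i.e. a projection $p$ for which there is an element $v$ with $v^*v=p$, $vv^*\le p$ and $vv^*\ne p$. -/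

import Mathlib

noncomputable section

namespace QNat

/-! ## Simple and purely infinite C⋆-algebras -/

/-- A (unital) C⋆-algebra is simple if it is nonzero and has no closed two-sided ideals other than
`0` and itself. -/
def IsSimpleCStar (A : Type*) [CStarAlgebra A] : Prop :=
  Nontrivial A ∧ ∀ I : TwoSidedIdeal A, IsClosed (I : Set A) → I = ⊥ ∨ I = ⊤

/-- A projection `p` is infinite if it is Murray-von Neumann equivalent to a proper
subprojection of itself. -/
def IsInfiniteProjection {A : Type*} [CStarAlgebra A] [PartialOrder A] (p : A) : Prop :=
  IsStarProjection p ∧ ∃ v : A, star v * v = p ∧ v * star v ≤ p ∧ v * star v ≠ p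

/-- A hereditary C⋆-subalgebra: a norm closed `*`-subalgebra `B` (not necessarily containing the
unit) such that `0 ≤ a ≤ b` and `b ∈ B` imply `a ∈ B`. -/
structure IsHereditary {A : Type*} [CStarAlgebra A] [PartialOrder A]
    (B : NonUnitalStarSubalgebra ℂ A) : Prop where
  isClosed : IsClosed (B : Set A)
  mem_of_le : ∀ a b : A, 0 ≤ a → a ≤ b → b ∈ B → a ∈ B

/-- Pure infiniteness (of a simple C⋆-algebra): every nonzero hereditary C⋆-subalgebra contains an
infinite projection. -/
def IsPurelyInfinite (A : Type*) [CStarAlgebra A] [PartialOrder A] [StarOrderedRing A] : Prop :=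
  ∀ B : NonUnitalStarSubalgebra ℂ A, IsHereditary B → B ≠ ⊥ →
    ∃ p ∈ B, IsInfiniteProjection p

/-! ## The defining relations -/

/-- Isometries `s n` (`n ≥ 1`), with range projections `e n = s n * star (s n)`, and a unitary `u`
satisfying the defining relations of `Q_ℕ`; since `u` is unitary, `u⁻ᵏ = (u⋆)ᵏ`. -/
structure Relations {B : Type*} [Ring B] [StarRing B] (s : ℕ+ → B) (u : B) : Prop where
  isometry : ∀ n, star (s n) * s n = 1
  unitary_mem : u ∈ unitary B
  mul : ∀ n m, s n * s m = s (n * m)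
  mul_u : ∀ n, s n * u = u ^ (n : ℕ) * s n
  sum_eq_one : ∀ n : ℕ+,
    ∑ k ∈ Finset.range (n : ℕ), u ^ k * (s n * star (s n)) * star u ^ k = 1

/-- `(A, s, u)` is the universal C⋆-algebra for the relations: `s`, `u` satisfy the relations,
they generate `A` as a C⋆-algebra, and any `t`, `w` satisfying the relations in a unital C⋆-algebra
(in the universe `v`) are the images of `s`, `u` under a unique unital `*`-homomorphism. -/
def IsUniversal.{v, w} (A : Type w) [CStarAlgebra A] (s : ℕ+ → A) (u : A) : Prop :=
  Relations s u ∧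
    (StarAlgebra.adjoin ℂ (Set.range s ∪ {u})).topologicalClosure = ⊤ ∧
    ∀ (B : Type v) [CStarAlgebra B] (t : ℕ+ → B) (w : B), Relations t w →
      ∃! φ : A →⋆ₐ[ℂ] B, (∀ n, φ (s n) = t n) ∧ φ u = w

/-! ## The free unital `*`-algebra on the generators -/

/-- Letters: the generators `s n`, `u` and their formal adjoints. -/
inductive Letter : Type
  | s (n : ℕ+)
  | sStar (n : ℕ+)
  | u
  | uStar

/-- The formal adjoint of a letter. -/
def Letter.adj : Letter → Letter
  | s n => sStar n
  | sStar n => s n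
  | u => uStar
  | uStar => u

lemma Letter.adj_adj (x : Letter) : x.adj.adj = x := by cases x <;> rfl

/-- The free unital complex `*`-algebra on the letters `s n` and `u`. -/
def Free : Type := FreeAlgebra ℂ Letter

namespace Free

instance : Ring Free := inferInstanceAs (Ring (FreeAlgebra ℂ Letter))
instance : Algebra ℂ Free := inferInstanceAs (Algebra ℂ (FreeAlgebra ℂ Letter))

/-- A letter as an element of the free `*`-algebra. -/
def of (x : Letter) : Free := FreeAlgebra.ι ℂ x

/-- An algebra map out of the free `*`-algebra is determined by letters. -/
def lift {B : Type*} [Ring B] [Algebra ℂ B] (f : Letter → B) : Free →ₐ[ℂ] B :=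
  FreeAlgebra.lift ℂ f

lemma lift_of {B : Type*} [Ring B] [Algebra ℂ B] (f : Letter → B) (x : Letter) :
    lift f (of x) = f x := FreeAlgebra.lift_ι_apply f x

lemma induction {P : Free → Prop} (h1 : ∀ c : ℂ, P (algebraMap ℂ Free c))
    (h2 : ∀ x, P (of x)) (h3 : ∀ a b, P a → P b → P (a * b))
    (h4 : ∀ a b, P a → P b → P (a + b)) (a : Free) : P a :=
  FreeAlgebra.induction ℂ Letter h1 h2 h3 h4 a

/-- The opposite algebra with scalars acting through complex conjugation. -/
abbrev twisted : Algebra ℂ Freeᵐᵒᵖ :=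
  ((algebraMap ℂ Freeᵐᵒᵖ).comp (starRingEnd ℂ)).toAlgebra' fun c x =>
    Algebra.commutes (starRingEnd ℂ c) x

/-- The adjoint, as a ring homomorphism to the opposite ring. -/
def adjHom : Free →+* Freeᵐᵒᵖ :=
  @AlgHom.toRingHom ℂ Free Freeᵐᵒᵖ _ _ _ _ twisted
    (@lift Freeᵐᵒᵖ _ twisted fun x => MulOpposite.op (of x.adj))

lemma adjHom_of (x : Letter) : adjHom (of x) = MulOpposite.op (of x.adj) :=
  @lift_of Freeᵐᵒᵖ _ twisted _ x

lemma adjHom_algebraMap (c : ℂ) :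
    adjHom (algebraMap ℂ Free c) = MulOpposite.op (algebraMap ℂ Free (starRingEnd ℂ c)) :=
  (@AlgHom.commutes ℂ Free Freeᵐᵒᵖ _ _ _ _ twisted
    (@lift Freeᵐᵒᵖ _ twisted fun x => MulOpposite.op (of x.adj)) c)

/-- The involution: conjugate linear, antimultiplicative, exchanging a generator and its formal
adjoint. -/
instance : StarRing Free where
  star x := (adjHom x).unop
  star_involutive x := by
    refine induction (P := fun x => (adjHom (adjHom x).unop).unop = x) ?_ ?_ ?_ ?_ x
    · intro c; simp [adjHom_algebraMap]
    · intro x; simp [adjHom_of, Letter.adj_adj]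
    · intro a b ha hb; simp [ha, hb]
    · intro a b ha hb; simp [ha, hb]
  star_mul a b := by simp
  star_add a b := by simp

lemma star_of (x : Letter) : star (of x) = of x.adj := by
  change (adjHom (of x)).unop = _
  rw [adjHom_of]; rfl

lemma star_algebraMap (c : ℂ) : star (algebraMap ℂ Free c) = algebraMap ℂ Free (star c) := by
  change (adjHom _).unop = _
  rw [adjHom_algebraMap]; rfl

instance : StarModule ℂ Free where
  star_smul c x := by
    rw [Algebra.smul_def, star_mul, star_algebraMap, Algebra.smul_def, Algebra.commutes]

/-- The generators. -/
def S (n : ℕ+) : Free := of (.s n)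
/-- The unitary generator. -/
def U : Free := of .u

lemma star_S (n : ℕ+) : star (S n) = of (.sStar n) := star_of _
lemma star_U : star U = of .uStar := star_of _

/-- The defining relations, as pairs of elements of the free `*`-algebra to be identified. -/
inductive Rel : Free → Free → Prop
  | isometry (n : ℕ+) : Rel (star (S n) * S n) 1
  | star_u_mul_u : Rel (star U * U) 1
  | u_mul_star_u : Rel (U * star U) 1
  | mul (n m : ℕ+) : Rel (S n * S m) (S (n * m))
  | mul_u (n : ℕ+) : Rel (S n * U) (U ^ (n : ℕ) * S n)
  | sum_eq_one (n : ℕ+) :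
      Rel (∑ k ∈ Finset.range (n : ℕ), U ^ k * (S n * star (S n)) * star U ^ k) 1

end Free

/-! ## The universal C⋆-seminorm -/

/-- A C⋆-seminorm on the free `*`-algebra which respects the defining relations. -/
structure IsAdmissible (p : Seminorm ℂ Free) : Prop where
  mul_le : ∀ x y, p (x * y) ≤ p x * p y
  star_mul_self : ∀ x, p (star x * x) = p x * p x
  rel : ∀ x y, Free.Rel x y → p (x - y) = 0

/-- The type of admissible C⋆-seminorms. -/
abbrev Adm : Type := {p : Seminorm ℂ Free // IsAdmissible p}

lemma isAdmissible_zero : IsAdmissible 0 where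
  mul_le := by simp
  star_mul_self := by simp
  rel := by simp

instance : Nonempty Adm := ⟨⟨0, isAdmissible_zero⟩⟩

namespace IsAdmissible

variable {p : Seminorm ℂ Free}

lemma le_star (h : IsAdmissible p) (x : Free) : p x ≤ p (star x) := by
  rcases (apply_nonneg p x).eq_or_lt with h0 | h0
  · rw [← h0]; exact apply_nonneg p _
  · have := h.mul_le (star x) x
    rw [h.star_mul_self] at this
    exact le_of_mul_le_mul_right this h0

lemma star_eq (h : IsAdmissible p) (x : Free) : p (star x) = p x :=
  le_antisymm (by simpa using h.le_star (star x)) (h.le_star x)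

lemma one_le (h : IsAdmissible p) : p 1 ≤ 1 := by
  have := h.star_mul_self 1
  rw [star_one, mul_one] at this
  nlinarith [apply_nonneg p (1 : Free)]

lemma le_one_of_rel (h : IsAdmissible p) {x : Free} (hx : Free.Rel (star x * x) 1) :
    p x ≤ 1 := by
  have h1 := h.rel _ _ hx
  have h2 : p (star x * x) ≤ p (star x * x - 1) + p 1 := by
    simpa using map_add_le_add p (star x * x - 1) 1
  rw [h.star_mul_self, h1] at h2
  nlinarith [h.one_le, apply_nonneg p x]

lemma of_le_one (h : IsAdmissible p) (x : Letter) : p (Free.of x) ≤ 1 := by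
  cases x with
  | s n => exact h.le_one_of_rel (.isometry n)
  | sStar n =>
    rw [← Free.star_S, h.star_eq]; exact h.le_one_of_rel (.isometry n)
  | u => exact h.le_one_of_rel .star_u_mul_u
  | uStar =>
    rw [← Free.star_U, h.star_eq]; exact h.le_one_of_rel .star_u_mul_u

end IsAdmissible

lemma bddAbove_adm (x : Free) : BddAbove (Set.range fun p : Adm => p.1 x) := by
  suffices h : ∃ C : ℝ, ∀ p : Adm, p.1 x ≤ C by
    obtain ⟨C, hC⟩ := h
    exact ⟨C, by rintro _ ⟨p, rfl⟩; exact hC p⟩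
  induction x using Free.induction with
  | h1 c =>
    refine ⟨‖c‖, fun p => ?_⟩
    rw [Algebra.algebraMap_eq_smul_one, map_smul_eq_mul]
    exact mul_le_of_le_one_right (norm_nonneg _) p.2.one_le
  | h2 x => exact ⟨1, fun p => p.2.of_le_one x⟩
  | h3 a b ha hb =>
    obtain ⟨C, hC⟩ := ha
    obtain ⟨D, hD⟩ := hb
    exact ⟨C * D, fun p => (p.2.mul_le a b).trans
      (mul_le_mul (hC p) (hD p) (apply_nonneg _ _) ((apply_nonneg _ _).trans (hC p)))⟩
  | h4 a b ha hb =>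
    obtain ⟨C, hC⟩ := ha
    obtain ⟨D, hD⟩ := hb
    exact ⟨C + D, fun p => (map_add_le_add p.1 a b).trans (add_le_add (hC p) (hD p))⟩

/-- The universal C⋆-seminorm: the largest C⋆-seminorm respecting the relations. -/
def univNorm (x : Free) : ℝ := ⨆ p : Adm, p.1 x

lemma le_univNorm (p : Adm) (x : Free) : p.1 x ≤ univNorm x := le_ciSup (bddAbove_adm x) p

lemma univNorm_le {x : Free} {C : ℝ} (h : ∀ p : Adm, p.1 x ≤ C) : univNorm x ≤ C := ciSup_le h

lemma univNorm_nonneg (x : Free) : 0 ≤ univNorm x := le_univNorm ⟨0, isAdmissible_zero⟩ x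

lemma univNorm_zero : univNorm 0 = 0 :=
  le_antisymm (univNorm_le fun p => by simp) (univNorm_nonneg _)

lemma univNorm_add_le (x y : Free) : univNorm (x + y) ≤ univNorm x + univNorm y :=
  univNorm_le fun p => (map_add_le_add p.1 x y).trans
    (add_le_add (le_univNorm p x) (le_univNorm p y))

lemma univNorm_neg (x : Free) : univNorm (-x) = univNorm x := by
  simp [univNorm]

lemma univNorm_mul_le (x y : Free) : univNorm (x * y) ≤ univNorm x * univNorm y :=
  univNorm_le fun p => (p.2.mul_le x y).trans
    (mul_le_mul (le_univNorm p x) (le_univNorm p y) (apply_nonneg _ _) (univNorm_nonneg _))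

lemma univNorm_smul_le (c : ℂ) (x : Free) : univNorm (c • x) ≤ ‖c‖ * univNorm x :=
  univNorm_le fun p => by
    rw [map_smul_eq_mul]
    exact mul_le_mul_of_nonneg_left (le_univNorm p x) (norm_nonneg _)

lemma univNorm_star (x : Free) : univNorm (star x) = univNorm x := by
  simp only [univNorm]
  exact iSup_congr fun p => p.2.star_eq x

lemma univNorm_mul_self_le (x : Free) : univNorm x * univNorm x ≤ univNorm (star x * x) := by
  rw [← sq, ← Real.le_sqrt (univNorm_nonneg _) (univNorm_nonneg _)]
  refine univNorm_le fun p => Real.le_sqrt_of_sq_le ?_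
  rw [sq, ← p.2.star_mul_self]
  exact le_univNorm p _

lemma univNorm_rel {x y : Free} (h : Free.Rel x y) : univNorm (x - y) = 0 :=
  le_antisymm (univNorm_le fun p => (p.2.rel x y h).le) (univNorm_nonneg _)

instance : SeminormedRing Free :=
  RingSeminorm.toSeminormedRing
    { toFun := univNorm
      map_zero' := univNorm_zero
      add_le' := univNorm_add_le
      neg' := univNorm_neg
      mul_le' := univNorm_mul_le }

lemma norm_def (x : Free) : ‖x‖ = univNorm x := rfl

instance : NormedSpace ℂ Free where
  norm_smul_le := univNorm_smul_le

/-! ## The C⋆-algebra `Q_ℕ` -/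

/-- The C⋆-algebra `Q_ℕ`: the Hausdorff completion of the free `*`-algebra in the universal
C⋆-seminorm. -/
def QN : Type := UniformSpace.Completion Free

namespace QN

open UniformSpace

instance : NormedRing QN := inferInstanceAs (NormedRing (Completion Free))
instance : CompleteSpace QN := inferInstanceAs (CompleteSpace (Completion Free))
instance : Algebra ℂ QN := inferInstanceAs (Algebra ℂ (Completion Free))
instance : NormedAlgebra ℂ QN where
  norm_smul_le := norm_smul_le (α := ℂ) (β := Completion Free)

/-- The canonical map from the free `*`-algebra. -/
def mk (x : Free) : QN := (x : Completion Free)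

lemma norm_mk (x : Free) : ‖mk x‖ = univNorm x := Completion.norm_coe x
lemma continuous_mk : Continuous mk := Completion.continuous_coe Free
lemma denseRange_mk : DenseRange mk := Completion.denseRange_coe
lemma mk_one : mk 1 = 1 := rfl
lemma mk_add (x y : Free) : mk (x + y) = mk x + mk y := Completion.coe_add x y
lemma mk_sub (x y : Free) : mk (x - y) = mk x - mk y := Completion.coe_sub x y
lemma mk_mul (x y : Free) : mk (x * y) = mk x * mk y := Completion.coe_mul x y
lemma mk_smul (c : ℂ) (x : Free) : mk (c • x) = c • mk x := Completion.coe_smul c x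

lemma induction {P : QN → Prop} (x : QN) (hp : IsClosed {x | P x}) (h : ∀ x, P (mk x)) : P x :=
  Completion.induction_on x hp h

lemma lipschitz_star : LipschitzWith 1 (star : Free → Free) :=
  LipschitzWith.of_dist_le_mul fun x y => by
    simp [dist_eq_norm, ← star_sub, norm_def, univNorm_star]

instance : Star QN := ⟨Completion.map (star : Free → Free)⟩

lemma star_mk (x : Free) : star (mk x) = mk (star x) :=
  Completion.map_coe lipschitz_star.uniformContinuous x

lemma continuous_star' : Continuous (star : QN → QN) := Completion.continuous_map

instance : StarRing QN where
  star_involutive x := by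
    induction x using induction with
    | hp => exact isClosed_eq (continuous_star'.comp continuous_star') continuous_id
    | h x => simp [star_mk]
  star_mul x y := by
    induction x using induction with
    | hp => exact isClosed_eq (continuous_star'.comp (by fun_prop))
              (continuous_const.mul continuous_star')
    | h x =>
      induction y using induction with
      | hp => exact isClosed_eq (continuous_star'.comp (by fun_prop))
                (continuous_star'.mul continuous_const)
      | h y => simp [star_mk, ← mk_mul]
  star_add x y := by
    induction x using induction with
    | hp => exact isClosed_eq (continuous_star'.comp (by fun_prop))
              (continuous_star'.add continuous_const)
    | h x =>
      induction y using induction with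
      | hp => exact isClosed_eq (continuous_star'.comp (by fun_prop))
                (continuous_const.add continuous_star')
      | h y => simp [star_mk, ← mk_add]

instance : CStarRing QN where
  norm_mul_self_le x := by
    induction x using induction with
    | hp => exact isClosed_le (by fun_prop)
              (continuous_norm.comp (continuous_star'.mul continuous_id))
    | h x =>
      rw [star_mk, ← mk_mul, norm_mk, norm_mk]
      exact univNorm_mul_self_le x

instance : StarModule ℂ QN where
  star_smul c x := by
    induction x using induction with
    | hp => exact isClosed_eq (continuous_star'.comp (continuous_const_smul c))
              ((continuous_const_smul (star c)).comp continuous_star')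
    | h x => rw [← mk_smul, star_mk, star_mk, star_smul, mk_smul]

instance : CStarAlgebra QN where

/-- The usual order of a C⋆-algebra. -/
instance : PartialOrder QN := CStarAlgebra.spectralOrder QN
instance : StarOrderedRing QN := CStarAlgebra.spectralOrderedRing QN

/-- The generating isometries `s n`, `n ≥ 1`. -/
def s (n : ℕ+) : QN := mk (Free.S n)

/-- The generating unitary `u`. -/
def u : QN := mk Free.U

/-- The canonical map from the free `*`-algebra, as a `*`-homomorphism. -/
def mkHom : Free →⋆ₐ[ℂ] QN where
  toFun := mk
  map_one' := mk_one
  map_mul' := mk_mul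
  map_zero' := rfl
  map_add' := mk_add
  commutes' _ := rfl
  map_star' x := (star_mk x).symm

lemma mkHom_rel {x y : Free} (h : Free.Rel x y) : mkHom x = mkHom y := by
  rw [← sub_eq_zero, ← map_sub, ← norm_eq_zero]
  exact (norm_mk _).trans (univNorm_rel h)

lemma mkHom_S (n : ℕ+) : mkHom (Free.S n) = s n := rfl
lemma mkHom_U : mkHom Free.U = u := rfl

/-- The generators of `Q_ℕ` satisfy the defining relations. -/
theorem relations : Relations s u where
  isometry n := by
    simpa [mkHom_S, mkHom_U, map_star] using mkHom_rel (.isometry n)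
  unitary_mem := by
    rw [Unitary.mem_iff]
    exact ⟨by simpa [mkHom_S, mkHom_U, map_star] using mkHom_rel .star_u_mul_u,
      by simpa [mkHom_S, mkHom_U, map_star] using mkHom_rel .u_mul_star_u⟩
  mul n m := by simpa [mkHom_S, mkHom_U, map_star] using mkHom_rel (.mul n m)
  mul_u n := by simpa [mkHom_S, mkHom_U, map_star] using mkHom_rel (.mul_u n)
  sum_eq_one n := by simpa [mkHom_S, mkHom_U, map_star] using mkHom_rel (.sum_eq_one n)

end QN

/-! ## The universal property -/

section Universal

open scoped CStarAlgebra

variable {B : Type*} [CStarAlgebra B]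

/-- The images of letters. -/
def letterMap (t : ℕ+ → B) (w : B) : Letter → B
  | .s n => t n
  | .sStar n => star (t n)
  | .u => w
  | .uStar => star w

/-- The `*`-homomorphism from the free `*`-algebra with prescribed values on the generators. -/
def freeLift (t : ℕ+ → B) (w : B) : Free →⋆ₐ[ℂ] B :=
  { Free.lift (letterMap t w) with
    map_star' := fun x => by
      change Free.lift (letterMap t w) (star x) = star (Free.lift (letterMap t w) x)
      induction x using Free.induction with
      | h1 c => simp [← algebraMap_star_comm]
      | h2 x => cases x <;> simp [Free.star_of, Free.lift_of, letterMap, Letter.adj]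
      | h3 a b ha hb => simp [ha, hb]
      | h4 a b ha hb => simp [ha, hb] }

lemma freeLift_S (t : ℕ+ → B) (w : B) (n : ℕ+) : freeLift t w (Free.S n) = t n :=
  Free.lift_of _ _

lemma freeLift_U (t : ℕ+ → B) (w : B) : freeLift t w Free.U = w :=
  Free.lift_of _ _

lemma freeLift_rel {t : ℕ+ → B} {w : B} (h : Relations t w) {x y : Free} (hxy : Free.Rel x y) :
    freeLift t w x = freeLift t w y := by
  cases hxy with
  | isometry n => simpa [freeLift_S, freeLift_U, map_star] using h.isometry n
  | star_u_mul_u => simpa [freeLift_S, freeLift_U, map_star] using (Unitary.mem_iff.1 h.unitary_mem).1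
  | u_mul_star_u => simpa [freeLift_S, freeLift_U, map_star] using (Unitary.mem_iff.1 h.unitary_mem).2
  | mul n m => simpa [freeLift_S, freeLift_U, map_star] using h.mul n m
  | mul_u n => simpa [freeLift_S, freeLift_U, map_star] using h.mul_u n
  | sum_eq_one n => simpa [freeLift_S, freeLift_U, map_star] using h.sum_eq_one n

/-- The C⋆-seminorm of a representation of the relations. -/
def repSeminorm (t : ℕ+ → B) (w : B) : Seminorm ℂ Free :=
  (normSeminorm ℂ B).comp (freeLift t w).toAlgHom.toLinearMap

lemma repSeminorm_apply (t : ℕ+ → B) (w : B) (x : Free) :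
    repSeminorm t w x = ‖freeLift t w x‖ := rfl

lemma isAdmissible_repSeminorm {t : ℕ+ → B} {w : B} (h : Relations t w) :
    IsAdmissible (repSeminorm t w) where
  mul_le x y := by simpa [repSeminorm_apply] using norm_mul_le _ _
  star_mul_self x := by
    simp [repSeminorm_apply, map_star, CStarRing.norm_star_mul_self]
  rel x y hxy := by simp [repSeminorm_apply, freeLift_rel h hxy]

lemma continuous_freeLift {t : ℕ+ → B} {w : B} (h : Relations t w) :
    Continuous (freeLift t w) :=
  (LipschitzWith.of_dist_le_mul (K := 1) fun x y => by
    rw [dist_eq_norm, dist_eq_norm, ← map_sub, NNReal.coe_one, one_mul]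
    exact le_univNorm ⟨_, isAdmissible_repSeminorm h⟩ (x - y)).continuous

/-- The `*`-homomorphism out of `Q_ℕ` with prescribed values on the generators. -/
def QN.lift {t : ℕ+ → B} {w : B} (h : Relations t w) : QN →⋆ₐ[ℂ] B :=
  let φ : QN →+* B := UniformSpace.Completion.extensionHom
    ((freeLift t w).toAlgHom.toRingHom : Free →+* B) (continuous_freeLift h)
  have hφ : ∀ x, φ (QN.mk x) = freeLift t w x := fun x =>
    UniformSpace.Completion.extensionHom_coe _ (continuous_freeLift h) x
  have hc : Continuous φ := UniformSpace.Completion.continuous_extension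
  { φ with
    commutes' := fun c => (hφ (algebraMap ℂ Free c)).trans (AlgHomClass.commutes _ c)
    map_star' := fun x => by
      change φ (star x) = star (φ x)
      induction x using QN.induction with
      | hp => exact isClosed_eq (hc.comp QN.continuous_star') (continuous_star.comp hc)
      | h x => rw [QN.star_mk, hφ, hφ, map_star] }

lemma QN.lift_mk {t : ℕ+ → B} {w : B} (h : Relations t w) (x : Free) :
    QN.lift h (QN.mk x) = freeLift t w x :=
  UniformSpace.Completion.extensionHom_coe _ (continuous_freeLift h) x

lemma QN.hom_ext {φ ψ : QN →⋆ₐ[ℂ] B} (hs : ∀ n, φ (QN.s n) = ψ (QN.s n))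
    (hu : φ QN.u = ψ QN.u) : φ = ψ := by
  have key : ∀ x : Free, φ (QN.mkHom x) = ψ (QN.mkHom x) := fun x => by
    induction x using Free.induction with
    | h1 c => rw [AlgHomClass.commutes, AlgHomClass.commutes, AlgHomClass.commutes]
    | h2 x =>
      cases x with
      | s n => exact hs n
      | sStar n => rw [← Free.star_S, map_star, map_star, map_star]; exact congrArg star (hs n)
      | u => exact hu
      | uStar => rw [← Free.star_U, map_star, map_star, map_star]; exact congrArg star hu
    | h3 a b ha hb => simp [ha, hb]
    | h4 a b ha hb => simp [ha, hb]
  ext x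
  induction x using QN.induction with
  | hp => exact isClosed_eq (map_continuous φ) (map_continuous ψ)
  | h x => exact key x

end Universal

/-- `Q_ℕ` is generated by the `s n` and `u`. -/
theorem QN.topologicalClosure_adjoin :
    (StarAlgebra.adjoin ℂ (Set.range QN.s ∪ {QN.u})).topologicalClosure = ⊤ := by
  have hs : ∀ n, QN.s n ∈ StarAlgebra.adjoin ℂ (Set.range QN.s ∪ {QN.u}) := fun n =>
    StarAlgebra.subset_adjoin ℂ _ (Or.inl ⟨n, rfl⟩)
  have hu : QN.u ∈ StarAlgebra.adjoin ℂ (Set.range QN.s ∪ {QN.u}) :=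
    StarAlgebra.subset_adjoin ℂ _ (Or.inr rfl)
  have key : ∀ x : Free, QN.mkHom x ∈ StarAlgebra.adjoin ℂ (Set.range QN.s ∪ {QN.u}) := fun x => by
    induction x using Free.induction with
    | h1 c => rw [AlgHomClass.commutes]; exact algebraMap_mem _ c
    | h2 x =>
      cases x with
      | s n => exact hs n
      | sStar n => rw [← Free.star_S, map_star]; exact star_mem (hs n)
      | u => exact hu
      | uStar => rw [← Free.star_U, map_star]; exact star_mem hu
    | h3 a b ha hb => rw [map_mul]; exact mul_mem ha hb
    | h4 a b ha hb => rw [map_add]; exact add_mem ha hb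
  refine eq_top_iff.2 fun x hx => ?_
  clear hx
  induction x using QN.induction with
  | hp => exact StarSubalgebra.isClosed_topologicalClosure
            (StarAlgebra.adjoin ℂ (Set.range QN.s ∪ {QN.u}))
  | h x => exact StarSubalgebra.le_topologicalClosure _ (key x)

/-- `Q_ℕ` is the universal C⋆-algebra for the relations. -/
theorem QN.isUniversal.{v} : IsUniversal.{v} QN QN.s QN.u := by
  refine ⟨QN.relations, QN.topologicalClosure_adjoin, fun B _ t w h => ⟨QN.lift h, ⟨fun n => ?_, ?_⟩, fun ψ hψ => ?_⟩⟩
  · exact (QN.lift_mk h _).trans (freeLift_S t w n)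
  · exact (QN.lift_mk h _).trans (freeLift_U t w)
  · refine QN.hom_ext (fun n => ?_) ?_
    · rw [hψ.1]; exact ((QN.lift_mk h _).trans (freeLift_S t w n)).symm
    · rw [hψ.2]; exact ((QN.lift_mk h _).trans (freeLift_U t w)).symm

end QNat

end

/-! The heart is `exists_isometry`: for every b ≠ 0 there is a with (ba)⋆(ba) = 1. This puts 1 into
every nonzero ideal. In a hereditary subalgebra containing b, the isometry v = ba gives a projection
vv⋆ equivalent to 1, which is infinite because s₂ is a proper isometry.

To find a, one compresses b⋆b to a nonzero scalar. The monomials uᵏ s_n s_m⋆ uˡ have dense span.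
Averaging the gauge action s_n ↦ χ(n) s_n, χ a character of ℕ+, over a compact torus gives a
faithful expectation E that kills the monomials with n ≠ m (`expect_mono`,
`eq_zero_of_expect_eq_zero`). On the range of E the representation on ℓ²(ℤ) is isometric
(`norm_rep_of_mem_closure`): up to limits, such elements are finite matrices over C⋆(u) with respect
to the isometries uⁱ s_N, and the representation is faithful on C⋆(u) because the bilateral shift
has the whole circle as spectrum. So E(b⋆b) ≠ 0 has a nonzero diagonal entry at some basis vector
δ_i.

That entry is recovered inside the algebra by the isometries V_t = uⁱ⁺ᵗ! s_N with N = (t!)²: V_t⋆ x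
V_t tends to the scalar `diag i x` (`tendsto_compress`). On monomials this is pure divisibility
arithmetic. Hence some compression of b⋆b is close to a nonzero scalar, so invertible, and can be
normalized to 1. -/

noncomputable section

namespace QNat

open Filter Topology

/-! ## Consequences of the relations -/

namespace Relations

variable {B : Type*} [CStarAlgebra B] {s : ℕ+ → B} {u : B}

/-- Integer powers of the unitary generator. -/
def uz (h : Relations s u) (k : ℤ) : B := ((⟨u, h.unitary_mem⟩ ^ k : unitary B) : B)

variable (h : Relations s u)

lemma uz_add (k l : ℤ) : h.uz (k + l) = h.uz k * h.uz l := by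
  simp only [uz, zpow_add]; rfl

lemma uz_zero : h.uz 0 = 1 := by simp [uz]

lemma uz_one : h.uz 1 = u := by simp [uz]

lemma uz_natCast (k : ℕ) : h.uz k = u ^ k := by simp [uz]

lemma star_uz (k : ℤ) : star (h.uz k) = h.uz (-k) := by
  simp only [uz, zpow_neg, ← Unitary.star_eq_inv, Unitary.coe_star]

lemma uz_mul_uz (k l : ℤ) : h.uz k * h.uz l = h.uz (k + l) := (h.uz_add k l).symm

lemma uz_mul_uz_mul (k l : ℤ) (x : B) : h.uz k * (h.uz l * x) = h.uz (k + l) * x := by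
  rw [← mul_assoc, h.uz_mul_uz]

lemma star_s_mul_s_mul (h : Relations s u) (n : ℕ+) (x : B) : star (s n) * (s n * x) = x := by
  rw [← mul_assoc, h.isometry, one_mul]

lemma s_mul_uz (n : ℕ+) (k : ℤ) : s n * h.uz k = h.uz (n * k) * s n := by
  have nat : ∀ k : ℕ, s n * h.uz k = h.uz (n * k) * s n := fun k => by
    induction k with
    | zero => simp [uz_zero]
    | succ k ih =>
      rw [Nat.cast_succ, uz_add, ← mul_assoc, ih, mul_assoc, uz_one, h.mul_u, ← h.uz_natCast,
        ← mul_assoc, uz_mul_uz, mul_add, mul_one]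
  obtain ⟨k, rfl | rfl⟩ := k.eq_nat_or_neg
  · exact nat k
  · calc s n * h.uz (-k) = h.uz (-(n * k)) * (h.uz (n * k) * s n) * h.uz (-k) := by
          rw [uz_mul_uz_mul]; simp [uz_zero]
      _ = _ := by
          rw [← nat, mul_assoc, mul_assoc, uz_mul_uz]
          simp [uz_zero]

lemma uz_mul_star_s (n : ℕ+) (k : ℤ) : h.uz k * star (s n) = star (s n) * h.uz (n * k) := by
  have := congrArg star (h.s_mul_uz n (-k))
  simpa [star_mul, star_uz] using this

lemma s_comm (h : Relations s u) (n m : ℕ+) : s n * s m = s m * s n := by rw [h.mul, h.mul, mul_comm]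

lemma star_s_comm (h : Relations s u) (n m : ℕ+) : star (s n) * star (s m) = star (s m) * star (s n) := by
  rw [← star_mul, ← star_mul, h.s_comm]

/-- The resolution of the identity, shaped for insertion between two factors of a product; most
computations below start by inserting it. -/
lemma sum_uz (N : ℕ+) :
    ∑ c ∈ Finset.range (N : ℕ), h.uz c * s N * (star (s N) * h.uz (-c)) = 1 := by
  rw [← h.sum_eq_one N]
  refine Finset.sum_congr rfl fun c _ => ?_
  rw [← h.star_uz, uz_natCast, star_pow]
  simp only [mul_assoc]

lemma star_s_uz_s_of_mul (N : ℕ+) (k : ℤ) : star (s N) * h.uz (N * k) * s N = h.uz k := by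
  rw [mul_assoc, ← s_mul_uz, h.star_s_mul_s_mul]

/-- The range projections of `uᶜ s_N`, `0 ≤ c < N`, are orthogonal. -/
lemma star_s_uz_s_of_lt (N : ℕ+) (r : ℕ) (h0 : r ≠ 0) (hr : r < N) :
    star (s N) * h.uz r * s N = 0 := by
  let := CStarAlgebra.spectralOrder B
  let := CStarAlgebra.spectralOrderedRing B
  -- Compress the sum relation by s_N. The term c = 0 is already 1, so the remaining positive terms
  -- sum to 0 and each of them vanishes.
  have h1 : ∑ c ∈ Finset.range (N : ℕ), star (star (s N) * h.uz (-c) * s N) *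
      (star (s N) * h.uz (-c) * s N) = 1 := by
    have h2 : star (s N) * 1 * s N = 1 := by rw [mul_one, h.isometry]
    rw [← h2, ← h.sum_uz N, Finset.mul_sum, Finset.sum_mul]
    refine Finset.sum_congr rfl fun c _ => ?_
    simp only [star_mul, star_star, star_uz, neg_neg, mul_assoc]
  have hmem : 0 ∈ Finset.range (N : ℕ) := by simp
  rw [← Finset.add_sum_erase _ _ hmem] at h1
  simp only [Nat.cast_zero, neg_zero, uz_zero, mul_one, h.isometry, star_one,
    add_eq_left] at h1
  rw [Finset.sum_eq_zero_iff_of_nonneg fun c _ => star_mul_self_nonneg _] at h1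
  have := h1 r (by simp [h0, hr])
  rw [CStarRing.star_mul_self_eq_zero_iff] at this
  simpa [star_uz, mul_assoc] using congrArg star this

/-- Reduce k modulo N: the multiple of N moves through s_N to the right, leaving a remainder
strictly between 0 and N. -/
lemma star_s_uz_s_of_not_dvd (N : ℕ+) (k : ℤ) (hk : ¬ (N : ℤ) ∣ k) :
    star (s N) * h.uz k * s N = 0 := by
  have hN : (0 : ℤ) < N := by exact_mod_cast N.pos
  obtain ⟨r, hr⟩ := Int.eq_ofNat_of_zero_le (Int.emod_nonneg k hN.ne')
  have hlt := Int.emod_lt_of_pos k hN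
  have h0 : r ≠ 0 := by
    rintro rfl
    exact hk (Int.dvd_of_emod_eq_zero (by simpa using hr))
  rw [← Int.emod_add_mul_ediv k N, uz_add, mul_assoc, mul_assoc, ← s_mul_uz, hr,
    ← mul_assoc, ← mul_assoc, h.star_s_uz_s_of_lt N r h0 (by rw [hr] at hlt; exact_mod_cast hlt),
    zero_mul]

/-! ### Monomials and their span -/

/-- The elements `uᵏ s_n s_m⋆ uˡ`, which span a dense `*`-subalgebra. -/
def mono (n m : ℕ+) (k l : ℤ) : B := h.uz k * s n * star (s m) * h.uz l

/-- The linear span of the elements `uᵏ s_n s_m⋆ uˡ`. -/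
def monoSpan : Submodule ℂ B :=
  Submodule.span ℂ {x | ∃ n m k l, x = h.mono n m k l}

lemma mono_mem (n m : ℕ+) (k l : ℤ) : h.mono n m k l ∈ h.monoSpan :=
  Submodule.subset_span ⟨n, m, k, l, rfl⟩

lemma monoSpan_induction {P : B → Prop} (hm : ∀ n m k l, P (h.mono n m k l)) (h0 : P 0)
    (ha : ∀ x y, P x → P y → P (x + y)) (hs : ∀ (c : ℂ) x, P x → P (c • x)) {x : B}
    (hx : x ∈ h.monoSpan) : P x :=
  Submodule.span_induction (by rintro _ ⟨n, m, k, l, rfl⟩; exact hm n m k l) h0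
    (fun x y _ _ => ha x y) (fun c x _ => hs c x) hx

lemma one_mem_monoSpan : 1 ∈ h.monoSpan := by
  have : (1 : B) = ∑ c ∈ Finset.range ((1 : ℕ+) : ℕ), h.mono 1 1 c (-c) := by
    rw [← h.sum_uz 1]; simp only [mono, mul_assoc]
  rw [this]
  exact Submodule.sum_mem _ fun c _ => h.mono_mem _ _ _ _

/-- The algebra rule for `s_p⋆ uᵏ s_n`. -/
lemma star_s_mul_mono (p n m : ℕ+) (k l : ℤ) : star (s p) * h.mono n m k l =
    ∑ c ∈ Finset.range (p : ℕ), (if (p : ℤ) ∣ k + n * c then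
      h.mono n (m * p) ((k + n * c) / p) (m * -c + l) else 0) := by
  have key : star (s p) * h.mono n m k l = ∑ c ∈ Finset.range (p : ℕ),
      (star (s p) * h.uz (k + n * c) * s p) * (s n * star (s (m * p)) * h.uz (m * -c + l)) := by
    -- Replace the 1 between s_n and s_m⋆ by the resolution of the identity for p, then move uᶜ left
    -- through s_n and u⁻ᶜ right through s_m⋆.
    calc _ = star (s p) * h.uz k * s n * 1 * star (s m) * h.uz l := by
            simp only [mono, mul_assoc, one_mul]
      _ = _ := by
        rw [← h.sum_uz p]
        simp only [Finset.mul_sum, Finset.sum_mul]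
        refine Finset.sum_congr rfl fun c _ => ?_
        calc _ = star (s p) * h.uz k * (s n * h.uz c) * s p * star (s p) *
              (h.uz (-c) * star (s m)) * h.uz l := by simp only [mul_assoc]
          _ = star (s p) * (h.uz k * h.uz (n * c)) * (s n * s p) * (star (s p) * star (s m)) *
              (h.uz (m * -c) * h.uz l) := by
            rw [s_mul_uz, uz_mul_star_s]; simp only [mul_assoc]
          _ = _ := by
            rw [uz_mul_uz, uz_mul_uz, h.s_comm n p, ← star_mul, h.mul m p]
            simp only [mul_assoc]
  rw [key]
  refine Finset.sum_congr rfl fun c _ => ?_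
  split_ifs with hd
  · obtain ⟨q, hq⟩ := hd
    rw [hq, star_s_uz_s_of_mul, Int.mul_ediv_cancel_left _ (by exact_mod_cast p.ne_zero), mono]
    simp only [mul_assoc]
  · rw [h.star_s_uz_s_of_not_dvd _ _ hd, zero_mul]

lemma mul_mem_of_mono {a : B} (ha : ∀ n m k l, a * h.mono n m k l ∈ h.monoSpan) {x : B}
    (hx : x ∈ h.monoSpan) : a * x ∈ h.monoSpan :=
  h.monoSpan_induction (P := fun x => a * x ∈ h.monoSpan) ha (by simp)
    (fun x y hx hy => by simpa only [mul_add] using add_mem hx hy)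
    (fun c x hx => by simpa only [mul_smul_comm] using Submodule.smul_mem _ c hx) hx

lemma uz_mul_mem (j : ℤ) {x : B} (hx : x ∈ h.monoSpan) : h.uz j * x ∈ h.monoSpan :=
  h.mul_mem_of_mono (fun n m k l => by
    have : h.uz j * h.mono n m k l = h.mono n m (j + k) l := by
      simp only [mono, mul_assoc, uz_mul_uz_mul]
    exact this ▸ h.mono_mem _ _ _ _) hx

lemma s_mul_mem (p : ℕ+) {x : B} (hx : x ∈ h.monoSpan) : s p * x ∈ h.monoSpan :=
  h.mul_mem_of_mono (fun n m k l => by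
    have : s p * h.mono n m k l = h.mono (p * n) m (p * k) l := by
      simp only [mono, ← mul_assoc, s_mul_uz]
      rw [mul_assoc (h.uz _) (s p), h.mul]
    exact this ▸ h.mono_mem _ _ _ _) hx

lemma star_s_mul_mem (p : ℕ+) {x : B} (hx : x ∈ h.monoSpan) : star (s p) * x ∈ h.monoSpan :=
  h.mul_mem_of_mono (fun n m k l => by
    rw [star_s_mul_mono]
    refine Submodule.sum_mem _ fun c _ => ?_
    split_ifs
    exacts [h.mono_mem _ _ _ _, zero_mem _]) hx

/-! ### Compressing by `s_N` -/

/-- Inserting the resolution of the identity for N, the term c survives only if N divides both a +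
nc and b − mc. Eliminating c shows that N would then divide nb + ma. -/
lemma compress_eq_zero (N n m : ℕ+) (a b : ℤ) (hN : ¬ (N : ℤ) ∣ n * b + m * a) :
    star (s N) * h.mono n m a b * s N = 0 := by
  calc _ = star (s N) * h.uz a * s n * 1 * star (s m) * h.uz b * s N := by
          simp only [mono, mul_assoc, one_mul]
    _ = ∑ c ∈ Finset.range (N : ℕ), (star (s N) * h.uz (a + n * c) * s N) * (s n * star (s m)) *
          (star (s N) * h.uz (m * -c + b) * s N) := by
        rw [← h.sum_uz N]
        simp only [Finset.mul_sum, Finset.sum_mul]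
        refine Finset.sum_congr rfl fun c _ => ?_
        calc _ = star (s N) * h.uz a * (s n * h.uz c) * s N * star (s N) *
              (h.uz (-c) * star (s m)) * h.uz b * s N := by simp only [mul_assoc]
          _ = star (s N) * (h.uz a * h.uz (n * c)) * (s n * s N) * (star (s N) * star (s m)) *
              (h.uz (m * -c) * h.uz b) * s N := by
            rw [s_mul_uz, uz_mul_star_s]; simp only [mul_assoc]
          _ = _ := by
            rw [uz_mul_uz, uz_mul_uz, h.s_comm n N, h.star_s_comm N m]
            simp only [mul_assoc]
    _ = 0 := Finset.sum_eq_zero fun c _ => by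
        by_cases h1 : (N : ℤ) ∣ a + n * c
        · by_cases h2 : (N : ℤ) ∣ m * -c + b
          · refine absurd ?_ hN
            have := dvd_add (h1.mul_left m) (h2.mul_left n)
            rwa [show (n * b + m * a : ℤ) = m * (a + n * c) + n * (m * -c + b) by ring]
          · rw [h.star_s_uz_s_of_not_dvd _ _ h2, mul_zero]
        · rw [h.star_s_uz_s_of_not_dvd _ _ h1, zero_mul, zero_mul]

/-- The matrix coefficients of `uᵏ e_n uˡ` with respect to the isometries `uⁱ s_N`, `n ∣ N`. -/
lemma compress_mono_self (N n : ℕ+) (hn : n ∣ N) (a b : ℤ) :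
    star (s N) * h.mono n n a b * s N =
      if (n : ℤ) ∣ b ∧ (N : ℤ) ∣ a + b then h.uz ((a + b) / N) else 0 := by
  obtain ⟨N', rfl⟩ := hn
  by_cases h1 : (n : ℤ) ∣ b
  -- When n ∣ b, the range of uᵇ s_N lies under e_n, so e_n can be dropped; otherwise that range is
  -- orthogonal to e_n.
  · have key : star (s (n * N')) * h.mono n n a b * s (n * N') =
        star (s (n * N')) * h.uz (a + b) * s (n * N') := by
      obtain ⟨q, rfl⟩ := h1
      calc _ = star (s (n * N')) * h.uz a * s n * (star (s n) * h.uz (n * q) * s n) * s N' := by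
            rw [← h.mul n N']; simp only [mono, mul_assoc]
        _ = star (s (n * N')) * h.uz a * (s n * h.uz q) * s N' := by
            rw [star_s_uz_s_of_mul]; simp only [mul_assoc]
        _ = _ := by
            rw [s_mul_uz, ← h.mul n N', uz_add]; simp only [mul_assoc]
    rw [key, if_congr (and_iff_right h1) rfl rfl]
    split_ifs with h2
    · obtain ⟨r, hr⟩ := h2
      rw [hr, star_s_uz_s_of_mul, Int.mul_ediv_cancel_left _ (by exact_mod_cast (n * N').ne_zero)]
    · exact h.star_s_uz_s_of_not_dvd _ _ h2
  · rw [if_neg fun h2 => h1 h2.1]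
    calc _ = star (s (n * N')) * h.uz a * s n * (star (s n) * h.uz b * s n) * s N' := by
          rw [← h.mul n N']; simp only [mono, mul_assoc]
      _ = 0 := by rw [h.star_s_uz_s_of_not_dvd _ _ h1]; simp

end Relations

/-! ### Isometries that compress monomials to scalars -/

namespace Relations

variable {B : Type*} [CStarAlgebra B] {s : ℕ+ → B} {u : B} (h : Relations s u)

/-- Factorials as positive integers. -/
def fac (t : ℕ) : ℕ+ := ⟨t.factorial, t.factorial_pos⟩

lemma eventually_le_fac (C : ℤ) : ∀ᶠ t in atTop, C ≤ (fac t : ℤ) := by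
  filter_upwards [eventually_ge_atTop C.toNat] with t ht
  have : t ≤ t.factorial := t.self_le_factorial
  simp only [fac, PNat.mk_coe]
  omega

/-- The isometries `uⁱ⁺ᵗ! s_N`, `N = (t!)²`, which eventually compress every element of `Q_ℕ` to a
scalar. -/
def iso (i : ℤ) (t : ℕ) : B := h.uz (i + fac t) * s (fac t ^ 2)

lemma star_iso_mul_iso (i : ℤ) (t : ℕ) : star (h.iso i t) * h.iso i t = 1 := by
  rw [iso, star_mul, mul_assoc, ← mul_assoc (star (h.uz _)), star_uz, uz_mul_uz, neg_add_cancel,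
    uz_zero, one_mul, h.isometry]

lemma uz_conj_mono (a : ℤ) (n m : ℕ+) (k l : ℤ) :
    h.uz (-a) * h.mono n m k l * h.uz a = h.mono n m (k - a) (l + a) := by
  simp only [mono, mul_assoc, uz_mul_uz, uz_mul_uz_mul, neg_add_eq_sub]

lemma iso_compress_eq (i : ℤ) (t : ℕ) (n m : ℕ+) (k l : ℤ) :
    star (h.iso i t) * h.mono n m k l * h.iso i t = star (s (fac t ^ 2)) *
      h.mono n m (k - (i + fac t)) (l + (i + fac t)) * s (fac t ^ 2) := by
  rw [iso, star_mul, star_uz, ← uz_conj_mono]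
  simp only [mul_assoc]

/-- The shift t! is eventually divisible by n, so it does not affect the test n ∣ i + l. When n ≠ m
it contributes (n − m)·t!, which dominates any constant yet stays below the modulus (t!)². -/
lemma eventually_iso_compress_mono (i : ℤ) (n m : ℕ+) (k l : ℤ) : ∀ᶠ t in atTop,
    star (h.iso i t) * h.mono n m k l * h.iso i t =
      (if n = m ∧ k + l = 0 ∧ (n : ℤ) ∣ i + l then (1 : ℂ) else 0) • (1 : B) := by
  by_cases hnm : n = m
  · subst hnm
    -- The first bound gives n ∣ t!; the second makes (t!)² ∣ k + l equivalent to k + l = 0.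
    filter_upwards [eventually_ge_atTop (n : ℕ), eventually_le_fac (|k + l| + 1)] with t h1 h2
    have hdvd : n ∣ fac t := PNat.dvd_iff.2 (Nat.dvd_factorial n.pos h1)
    have hdvd' : (n : ℤ) ∣ fac t := by exact_mod_cast PNat.dvd_iff.1 hdvd
    rw [iso_compress_eq, h.compress_mono_self _ _ (hdvd.trans (dvd_pow_self _ two_ne_zero)),
      show k - (i + (fac t : ℤ)) + (l + (i + fac t)) = k + l by ring]
    have e1 : (n : ℤ) ∣ l + (i + fac t) ↔ (n : ℤ) ∣ i + l := by
      rw [← add_assoc, add_comm l i]; exact dvd_add_left hdvd'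
    have e2 : (((fac t ^ 2 : ℕ+) : ℕ) : ℤ) ∣ k + l ↔ k + l = 0 := by
      refine ⟨fun hd => Int.eq_zero_of_abs_lt_dvd hd ?_, fun h0 => h0 ▸ dvd_zero _⟩
      push_cast
      nlinarith [abs_nonneg (k + l)]
    by_cases hc : k + l = 0 ∧ (n : ℤ) ∣ i + l
    · rw [if_pos ⟨e1.2 hc.2, e2.2 hc.1⟩, if_pos ⟨rfl, hc⟩, hc.1, Int.zero_ediv, uz_zero, one_smul]
    · rw [if_neg fun h' => hc ⟨e2.1 h'.2, e1.1 h'.1⟩, if_neg fun h' => hc h'.2, zero_smul]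
  · set C : ℤ := n * (l + i) + m * (k - i) with hC
    set D : ℤ := n - m with hD
    have hD0 : 1 ≤ |D| := Int.one_le_abs (sub_ne_zero.2 (by exact_mod_cast hnm))
    -- With F = t! this size forces 0 < |C + D·F| < F², so F² cannot divide C + D·F.
    filter_upwards [eventually_le_fac (|C| + |D| + 2)] with t ht
    rw [iso_compress_eq, if_neg fun h' => hnm h'.1, zero_smul]
    refine h.compress_eq_zero _ _ _ _ _ fun hd => ?_
    rw [show (n * (l + (i + fac t)) + m * (k - (i + fac t)) : ℤ) = C + D * fac t by
      rw [hC, hD]; ring] at hd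
    have hF : (0 : ℤ) < fac t := by exact_mod_cast (fac t).pos
    have habs : |D * (fac t : ℤ)| = |D| * fac t := by rw [abs_mul, abs_of_pos hF]
    have h0 : C + D * fac t = 0 := by
      refine Int.eq_zero_of_abs_lt_dvd hd ?_
      push_cast
      have := abs_add_le C (D * fac t)
      rw [habs] at this
      nlinarith [abs_nonneg C]
    have : |C| = |D| * fac t := by rw [← habs, eq_neg_of_add_eq_zero_left h0, abs_neg]
    nlinarith [abs_nonneg C]

end Relations

/-! ### Density of the monomials -/

namespace QN

open Relations

/-- Left invariance under the generators and their adjoints is enough: applied to 1 it puts the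
image of the free algebra in the span, with no formula for a product of two monomials. -/
lemma mkHom_mul_mem (x : Free) :
    ∀ y ∈ relations.monoSpan, mkHom x * y ∈ relations.monoSpan := by
  induction x using Free.induction with
  | h1 c =>
    intro y hy
    rw [AlgHomClass.commutes, ← Algebra.smul_def]
    exact Submodule.smul_mem _ c hy
  | h2 x =>
    intro y hy
    cases x with
    | s n => exact relations.s_mul_mem n hy
    | sStar n =>
      rw [← Free.star_S, map_star]; exact relations.star_s_mul_mem n hy
    | u =>
      have := relations.uz_mul_mem 1 hy
      rwa [uz_one] at this
    | uStar =>
      have := relations.uz_mul_mem (-1) hy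
      rw [← star_uz, uz_one] at this
      rw [← Free.star_U, map_star]; exact this
  | h3 a b ha hb => intro y hy; rw [map_mul, mul_assoc]; exact ha _ (hb _ hy)
  | h4 a b ha hb => intro y hy; rw [map_add, add_mul]; exact add_mem (ha _ hy) (hb _ hy)

lemma mk_mem_monoSpan (x : Free) : mk x ∈ relations.monoSpan := by
  have := mkHom_mul_mem x 1 relations.one_mem_monoSpan
  rwa [mul_one] at this

/-- To prove a closed linear statement on `Q_ℕ` it suffices to check it on `uᵏ s_n s_m⋆ uˡ`. -/
lemma induction_mono {P : QN → Prop} (hc : IsClosed {x | P x})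
    (hm : ∀ n m k l, P (relations.mono n m k l)) (h0 : P 0)
    (ha : ∀ x y, P x → P y → P (x + y)) (hs : ∀ (c : ℂ) x, P x → P (c • x)) (x : QN) : P x :=
  induction x hc fun x => relations.monoSpan_induction hm h0 ha hs (mk_mem_monoSpan x)

end QN

/-! ## The representation on `ℓ²(ℤ)` -/

/-- The Hilbert space `ℓ²(ℤ)`. -/
abbrev L2Z : Type := lp (fun _ : ℤ => ℂ) 2

namespace L2Z

/-- The standard orthonormal basis. -/
def e (k : ℤ) : L2Z := lp.single 2 k (1 : ℂ)

lemma inner_e_left (k : ℤ) (f : L2Z) : inner ℂ (e k) f = f k := by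
  rw [e, lp.inner_single_left]; simp

lemma inner_e_e (k l : ℤ) : inner ℂ (e k) (e l) = if k = l then (1 : ℂ) else 0 := by
  rw [inner_e_left, e]
  simp [Pi.single_apply]

lemma orthonormal_e : Orthonormal ℂ e := orthonormal_iff_ite.2 inner_e_e

lemma ext_inner {f g : L2Z} (h : ∀ k, inner ℂ (e k) f = inner ℂ (e k) g) : f = g := by
  ext k
  simpa only [inner_e_left] using h k

lemma ext_op {S T : L2Z →L[ℂ] L2Z} (h : ∀ k, S (e k) = T (e k)) : S = T :=
  lp.ext_continuousLinearMap (by simp) fun k => by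
    refine ContinuousLinearMap.ext_ring ?_
    exact h k

/-- The isometry mapping the standard basis to an orthonormal family. -/
def isometry {v : ℤ → L2Z} (hv : Orthonormal ℂ v) : L2Z →L[ℂ] L2Z :=
  hv.orthogonalFamily.linearIsometry.toContinuousLinearMap

lemma isometry_e {v : ℤ → L2Z} (hv : Orthonormal ℂ v) (k : ℤ) : isometry hv (e k) = v k :=
  (hv.orthogonalFamily.linearIsometry_apply_single (i := k) (1 : ℂ)).trans (by simp)

lemma star_isometry_mul {v : ℤ → L2Z} (hv : Orthonormal ℂ v) :
    star (isometry hv) * isometry hv = 1 :=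
  hv.orthogonalFamily.linearIsometry.adjoint_comp_self

lemma orthonormal_mul (n : ℕ+) : Orthonormal ℂ fun k : ℤ => e (n * k) :=
  orthonormal_e.comp _ (mul_right_injective₀ (by exact_mod_cast n.ne_zero))

lemma orthonormal_add (j : ℤ) : Orthonormal ℂ fun k : ℤ => e (k + j) :=
  orthonormal_e.comp _ (add_left_injective j)

lemma orthonormal_rotate (z : Circle) : Orthonormal ℂ fun k : ℤ => ((z ^ k : Circle) : ℂ) • e k := by
  refine orthonormal_iff_ite.2 fun k l => ?_
  rw [inner_smul_left, inner_smul_right, inner_e_e]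
  split_ifs with h
  · subst h
    rw [mul_one, ← Complex.normSq_eq_conj_mul_self, Circle.normSq_coe, Complex.ofReal_one]
  · simp

/-- The isometry `δ_k ↦ δ_{nk}`. -/
def S (n : ℕ+) : L2Z →L[ℂ] L2Z := isometry (orthonormal_mul n)

/-- The translation `δ_k ↦ δ_{k+j}`. -/
def T (j : ℤ) : L2Z →L[ℂ] L2Z := isometry (orthonormal_add j)

/-- The diagonal unitary `δ_k ↦ zᵏ δ_k`. -/
def D (z : Circle) : L2Z →L[ℂ] L2Z := isometry (orthonormal_rotate z)

lemma S_e (n : ℕ+) (k : ℤ) : S n (e k) = e (n * k) := isometry_e _ _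
lemma T_e (j k : ℤ) : T j (e k) = e (k + j) := isometry_e _ _
lemma D_e (z : Circle) (k : ℤ) : D z (e k) = ((z ^ k : Circle) : ℂ) • e k := isometry_e _ _

lemma T_mul (i j : ℤ) : T i * T j = T (i + j) := ext_op fun k => by
  rw [mul_apply_eq_comp, T_e, T_e, T_e]; congr 1; ring

lemma T_zero : T 0 = 1 := ext_op fun k => by simp [T_e]

lemma star_T (j : ℤ) : star (T j) = T (-j) := by
  calc star (T j) = star (T j) * (T j * T (-j)) := by rw [T_mul]; simp [T_zero]
    _ = T (-j) := by rw [← mul_assoc, T, star_isometry_mul, one_mul]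

lemma T_pow (j : ℕ) : T 1 ^ j = T j := by
  induction j with
  | zero => simp [T_zero]
  | succ j ih => rw [pow_succ, ih, T_mul]; simp

lemma star_S_e (n : ℕ+) (k : ℤ) : star (S n) (e k) = if (n : ℤ) ∣ k then e (k / n) else 0 := by
  split_ifs with h
  · obtain ⟨q, rfl⟩ := h
    rw [Int.mul_ediv_cancel_left _ (by exact_mod_cast n.ne_zero), ← S_e,
      ← mul_apply_eq_comp, S, star_isometry_mul, one_apply_eq_self]
  · refine ext_inner fun l => ?_
    rw [ContinuousLinearMap.star_eq_adjoint, ContinuousLinearMap.adjoint_inner_right, S_e,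
      inner_e_e, if_neg (by rintro rfl; exact h (dvd_mul_right _ _)), inner_zero_right]

lemma range_projection_e (n : ℕ+) (k : ℤ) :
    (S n * star (S n)) (e k) = if (n : ℤ) ∣ k then e k else 0 := by
  rw [mul_apply_eq_comp, star_S_e]
  split_ifs with h
  · rw [S_e, Int.mul_ediv_cancel' h]
  · simp

lemma relations : Relations S (T 1) where
  isometry n := star_isometry_mul _
  unitary_mem := by
    rw [Unitary.mem_iff, star_T, T_mul, T_mul]; simp [T_zero]
  mul n m := ext_op fun k => by
    rw [mul_apply_eq_comp, S_e, S_e, S_e]; congr 1; push_cast; ring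
  mul_u n := ext_op fun k => by
    rw [T_pow, mul_apply_eq_comp, mul_apply_eq_comp, T_e, S_e, S_e, T_e]
    congr 1; ring
  sum_eq_one n := ext_op fun k => by
    have hn : (0 : ℤ) < n := by exact_mod_cast n.pos
    -- On δ_k only the translate with c ≡ k modulo n acts nontrivially.
    have key : ∀ c ∈ Finset.range (n : ℕ),
        (T 1 ^ c * (S n * star (S n)) * star (T 1) ^ c) (e k) =
          if c = (k % n).toNat then e k else 0 := by
      intro c hc
      have hc' : (c : ℤ) < n := by exact_mod_cast Finset.mem_range.1 hc
      rw [← star_pow, T_pow, star_T, mul_apply_eq_comp,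
        mul_apply_eq_comp, T_e, range_projection_e, apply_ite (T c), map_zero, T_e]
      have h1 := Int.emod_nonneg k hn.ne'
      have h2 : (n : ℤ) ∣ k + -c ↔ c = (k % n).toNat := by
        rw [← sub_eq_add_neg, ← Int.modEq_iff_dvd, Int.ModEq,
          Int.emod_eq_of_lt (Int.natCast_nonneg c) hc']
        omega
      rw [if_congr h2 rfl rfl]; simp
    rw [sum_apply, Finset.sum_congr rfl key, Finset.sum_ite_eq', if_pos]
    · rfl
    · have h1 := Int.emod_nonneg k hn.ne'
      have h2 := Int.emod_lt_of_pos k hn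
      rw [Finset.mem_range]; omega

/-- The bilateral shift is unitarily equivalent to its rotations. -/
lemma D_mul_T_mul_D (z : Circle) : D z * T 1 * D z⁻¹ = (z : ℂ) • T 1 := ext_op fun k => by
  simp only [mul_apply_eq_comp, D_e, map_smul, T_e, smul_apply,
    smul_smul, ← Circle.coe_mul]
  congr 2
  rw [inv_zpow, zpow_add, zpow_one, inv_mul_cancel_left]

lemma D_mul_D (z : Circle) : D z * D z⁻¹ = 1 := ext_op fun k => by
  simp only [mul_apply_eq_comp, D_e, map_smul, smul_smul, ← Circle.coe_mul]
  simp

lemma D_mul_D' (z : Circle) : D z⁻¹ * D z = 1 := by simpa using D_mul_D z⁻¹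

instance : Nontrivial L2Z :=
  ⟨e 0, 0, fun h => by have := inner_e_e 0 0; simp [h] at this⟩

lemma T_mem_unitary : T 1 ∈ unitary (L2Z →L[ℂ] L2Z) := relations.unitary_mem

/-- The spectrum of the bilateral shift is the whole circle. -/
lemma sphere_subset_spectrum : Metric.sphere (0 : ℂ) 1 ⊆ spectrum ℂ (T 1) := by
  intro w hw
  -- Any single spectral point suffices: it lies on the circle, and conjugation by `D c` rotates the
  -- spectrum, carrying z to w.
  obtain ⟨z, hz⟩ := spectrum.nonempty (T 1)
  have hz1 : z ∈ Metric.sphere (0 : ℂ) 1 := spectrum.subset_circle_of_unitary T_mem_unitary hz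
  have hz0 : z ≠ 0 := by rintro rfl; simp at hz1
  obtain ⟨c, hc⟩ : ∃ c : Circle, (c : ℂ) = w * z⁻¹ := by
    refine ⟨⟨w * z⁻¹, mem_sphere_zero_iff_norm.2 ?_⟩, rfl⟩
    rw [norm_mul, norm_inv, mem_sphere_zero_iff_norm.1 hw, mem_sphere_zero_iff_norm.1 hz1]
    simp
  have hcz : (c : ℂ) * z = w := by rw [hc, inv_mul_cancel_right₀ hz0]
  have h1 : Circle.toUnits c • z ∈ spectrum ℂ (Circle.toUnits c • T 1) :=
    spectrum.smul_mem_smul_iff.2 hz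
  have h2 : Circle.toUnits c • T 1 = D c * T 1 * D c⁻¹ := (D_mul_T_mul_D c).symm
  have h3 := spectrum.units_conjugate (R := ℂ) (a := T 1)
    (u := ⟨D c, D c⁻¹, D_mul_D c, D_mul_D' c⟩)
  rw [h2] at h1
  rw [← hcz, ← h3]
  exact h1

end L2Z

/-! ### Faithfulness on C⋆(u) -/

namespace QN

/-- The representation of `Q_ℕ` on `ℓ²(ℤ)`. -/
def rep : QN →⋆ₐ[ℂ] (L2Z →L[ℂ] L2Z) := QN.lift L2Z.relations

lemma rep_s (n : ℕ+) : rep (s n) = L2Z.S n := (QN.lift_mk L2Z.relations _).trans (freeLift_S _ _ n)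

lemma rep_u : rep u = L2Z.T 1 := (QN.lift_mk L2Z.relations _).trans (freeLift_U _ _)

/-- `rep` is faithful on the C⋆-algebra generated by `u`. -/
lemma eq_zero_of_rep_eq_zero_of_mem_elemental {z : QN} (hz : z ∈ StarAlgebra.elemental ℂ u)
    (h0 : rep z = 0) : z = 0 := by
  have hu : IsStarNormal u :=
    ⟨((Unitary.mem_iff.1 relations.unitary_mem).1.trans
      (Unitary.mem_iff.1 relations.unitary_mem).2.symm)⟩
  have hT : IsStarNormal (rep u) := by rw [rep_u]; exact isStarNormal_of_mem_unitary L2Z.T_mem_unitary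
  -- Write z = f(u). Then f vanishes on the spectrum of the shift, which is the whole circle and so
  -- contains the spectrum of u.
  obtain ⟨f, rfl⟩ : z ∈ Set.range (cfc (R := ℂ) · u) := by rwa [range_cfc ℂ hu]
  by_cases hf : ContinuousOn f (spectrum ℂ u)
  · have h1 : cfc f (rep u) = 0 := (rep.map_cfc f u hf (map_continuous rep) hu hT).symm.trans h0
    have hsub : spectrum ℂ u ⊆ spectrum ℂ (rep u) := by
      rw [rep_u]
      exact (spectrum.subset_circle_of_unitary relations.unitary_mem).trans
        L2Z.sphere_subset_spectrum
    have hsub' : spectrum ℂ (rep u) ⊆ spectrum ℂ u := AlgHom.spectrum_apply_subset rep u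
    have h2 : (spectrum ℂ (rep u)).EqOn f 0 :=
      eqOn_of_cfc_eq_cfc (by rw [h1]; exact (cfc_zero ℂ (rep u)).symm) (hf := hf.mono hsub')
        (hg := continuousOn_const) (ha := hT)
    exact (cfc_congr (h2.mono hsub)).trans (cfc_zero ℂ u)
  -- For f not continuous on the spectrum, `cfc` has the default value 0.
  · exact cfc_apply_of_not_continuousOn u hf

instance : Nontrivial QN := rep.toRingHom.domain_nontrivial

end QN

/-! ## The gauge-invariant part -/

namespace Relations

variable {B : Type*} [CStarAlgebra B] {s : ℕ+ → B} {u : B} (h : Relations s u)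

lemma uz_mem_elemental (k : ℤ) : h.uz k ∈ StarAlgebra.elemental ℂ u := by
  obtain ⟨k, rfl | rfl⟩ := k.eq_nat_or_neg
  · rw [uz_natCast]; exact pow_mem (StarAlgebra.elemental.self_mem ℂ u) k
  · rw [← star_uz, uz_natCast]
    exact star_mem (pow_mem (StarAlgebra.elemental.self_mem ℂ u) k)

/-- Matrix multiplication of coefficients; it makes `coeffAlgebra` closed under products. -/
lemma coeff_mul (N : ℕ+) (x y z w : B) :
    star (s N) * (x * (y * z) * w) * s N = ∑ c ∈ Finset.range (N : ℕ),
      (star (s N) * (x * y * h.uz c) * s N) * (star (s N) * (h.uz (-c) * z * w) * s N) := by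
  calc _ = star (s N) * x * y * 1 * z * w * s N := by simp only [mul_assoc, one_mul]
    _ = _ := by
      rw [← h.sum_uz N]
      simp only [Finset.mul_sum, Finset.sum_mul, mul_assoc]

/-- The elements of `B` whose matrix coefficients with respect to the isometries `uⁱ s_N` lie in
the C⋆-algebra generated by `u`. -/
def coeffAlgebra (N : ℕ+) : NonUnitalStarSubalgebra ℂ B where
  carrier := {z | ∀ i j : ℤ,
    star (s N) * (h.uz i * z * h.uz j) * s N ∈ StarAlgebra.elemental ℂ u}
  add_mem' hx hy i j := by
    simpa only [mul_add, add_mul] using add_mem (hx i j) (hy i j)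
  zero_mem' i j := by simp
  mul_mem' hx hy i j := by
    rw [h.coeff_mul]
    exact sum_mem fun c _ => mul_mem (hx _ _) (hy _ _)
  smul_mem' c x hx i j := by
    simpa only [mul_smul_comm, smul_mul_assoc] using
      SMulMemClass.smul_mem c (hx i j)
  star_mem' {x} hx i j := by
    have := star_mem (hx (-j) (-i))
    simpa only [star_mul, star_star, star_uz, neg_neg, mul_assoc] using this

lemma mem_coeffAlgebra {N : ℕ+} {z : B} : z ∈ h.coeffAlgebra N ↔ ∀ i j : ℤ,
    star (s N) * (h.uz i * z * h.uz j) * s N ∈ StarAlgebra.elemental ℂ u := Iff.rfl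

lemma isClosed_coeffAlgebra (N : ℕ+) : IsClosed (h.coeffAlgebra N : Set B) := by
  have : (h.coeffAlgebra N : Set B) = ⋂ i : ℤ, ⋂ j : ℤ,
      (fun z => star (s N) * (h.uz i * z * h.uz j) * s N) ⁻¹' (StarAlgebra.elemental ℂ u) := by
    ext z
    simp only [Set.mem_iInter]
    exact Iff.rfl
  rw [this]
  exact isClosed_iInter fun i => isClosed_iInter fun j =>
    (StarAlgebra.elemental.isClosed ℂ u).preimage (by fun_prop)

/-- Placing a resolution of the identity on each side of z rebuilds z from finitely many
coefficients. -/
lemma eq_zero_of_coeff (N : ℕ+) {z : B}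
    (hz : ∀ i j : ℤ, star (s N) * (h.uz i * z * h.uz j) * s N = 0) : z = 0 := by
  calc z = 1 * z * 1 := by simp
    _ = ∑ c ∈ Finset.range (N : ℕ), ∑ d ∈ Finset.range (N : ℕ), h.uz c * s N *
        (star (s N) * (h.uz (-c) * z * h.uz d) * s N) * (star (s N) * h.uz (-d)) := by
      conv_lhs => rw [← h.sum_uz N]
      simp only [Finset.sum_mul, Finset.mul_sum, mul_assoc]
      rw [Finset.sum_comm]
    _ = 0 := by simp [hz]

lemma mono_mem_coeffAlgebra {n N : ℕ+} (hn : n ∣ N) (k l : ℤ) :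
    h.mono n n k l ∈ h.coeffAlgebra N := by
  rw [mem_coeffAlgebra]
  intro i j
  have : h.uz i * h.mono n n k l * h.uz j = h.mono n n (i + k) (l + j) := by
    simp only [mono, mul_assoc, uz_mul_uz, uz_mul_uz_mul]
  rw [this, h.compress_mono_self N n hn]
  split_ifs
  exacts [h.uz_mem_elemental _, zero_mem _]

/-- The linear span of the elements `uᵏ e_n uˡ`. -/
def fixSpan : Submodule ℂ B := Submodule.span ℂ {x | ∃ n k l, x = h.mono n n k l}

lemma mono_mem_fixSpan (n : ℕ+) (k l : ℤ) : h.mono n n k l ∈ h.fixSpan :=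
  Submodule.subset_span ⟨n, k, l, rfl⟩

/-- Asking for all multiples N of n lets a sum be treated with a common multiple. -/
lemma exists_mem_coeffAlgebra {z : B} (hz : z ∈ h.fixSpan) :
    ∃ n : ℕ+, ∀ N, n ∣ N → z ∈ h.coeffAlgebra N := by
  induction hz using Submodule.span_induction with
  | mem x hx =>
    obtain ⟨n, k, l, rfl⟩ := hx
    exact ⟨n, fun N hN => h.mono_mem_coeffAlgebra hN k l⟩
  | zero => exact ⟨1, fun N _ => zero_mem _⟩
  | add x y _ _ hx hy =>
    obtain ⟨n, hn⟩ := hx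
    obtain ⟨m, hm⟩ := hy
    exact ⟨n * m, fun N hN => add_mem (hn N ((dvd_mul_right _ _).trans hN))
      (hm N ((dvd_mul_left _ _).trans hN))⟩
  | smul c x _ hx =>
    obtain ⟨n, hn⟩ := hx
    exact ⟨n, fun N hN => SMulMemClass.smul_mem c (hn N hN)⟩

end Relations

/-! ### Isometry of the representation on the gauge-invariant part -/

namespace QN

open Relations

/-- An injective `*`-homomorphism of C⋆-algebras is isometric. Injectivity is checked on the
coefficients, which lie in C⋆(u). -/
lemma norm_rep_of_mem_coeffAlgebra {N : ℕ+} {z : QN} (hz : z ∈ relations.coeffAlgebra N) :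
    ‖rep z‖ = ‖z‖ := by
  have : IsClosed (relations.coeffAlgebra N : Set QN) := relations.isClosed_coeffAlgebra N
  let φ : relations.coeffAlgebra N →⋆ₙₐ[ℂ] (L2Z →L[ℂ] L2Z) :=
    (rep : QN →⋆ₙₐ[ℂ] (L2Z →L[ℂ] L2Z)).comp
      (NonUnitalStarSubalgebraClass.subtype (relations.coeffAlgebra N))
  have hφ : Function.Injective φ := by
    rw [injective_iff_map_eq_zero]
    intro x hx
    have hx' : rep (x : QN) = 0 := hx
    refine Subtype.ext (relations.eq_zero_of_coeff N fun i j => ?_)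
    refine eq_zero_of_rep_eq_zero_of_mem_elemental (relations.mem_coeffAlgebra.1 x.2 i j) ?_
    simp [hx']
  exact NonUnitalStarAlgHom.norm_map φ hφ ⟨z, hz⟩

/-- `rep` is isometric on the closed span of the elements `uᵏ e_n uˡ`. -/
lemma norm_rep_of_mem_closure {z : QN} (hz : z ∈ relations.fixSpan.topologicalClosure) :
    ‖rep z‖ = ‖z‖ := by
  have hc : IsClosed {z : QN | ‖rep z‖ = ‖z‖} :=
    isClosed_eq (map_continuous rep).norm continuous_norm
  refine closure_minimal (fun x hx => ?_) hc hz
  obtain ⟨n, hn⟩ := relations.exists_mem_coeffAlgebra hx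
  exact norm_rep_of_mem_coeffAlgebra (hn n dvd_rfl)

end QN

/-! ## The gauge action and its conditional expectation -/

namespace Relations

lemma map_uz {A B : Type*} [CStarAlgebra A] [CStarAlgebra B] {s : ℕ+ → A} {u : A} {t : ℕ+ → B}
    {w : B} (h : Relations s u) (h' : Relations t w) (φ : A →⋆ₐ[ℂ] B) (hφ : φ u = w) (k : ℤ) :
    φ (h.uz k) = h'.uz k := by
  obtain ⟨k, rfl | rfl⟩ := k.eq_nat_or_neg
  · rw [uz_natCast, uz_natCast, map_pow, hφ]
  · rw [← star_uz, ← star_uz, uz_natCast, uz_natCast, map_star, map_pow, hφ]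

end Relations

/-- The compact group of all families of phases; the values at the primes parametrise the
characters of `ℕ+`. -/
abbrev Gauge : Type := ℕ → Circle

namespace Gauge

open MeasureTheory

instance : MeasurableSpace Gauge := borel _
instance : BorelSpace Gauge := ⟨rfl⟩

/-- The normalized Haar measure. -/
def haar : Measure Gauge := Measure.haarMeasure ⊤

instance : IsProbabilityMeasure haar := ⟨Measure.haarMeasure_self (K₀ := ⊤)⟩
instance : haar.IsMulLeftInvariant := inferInstanceAs (Measure.haarMeasure ⊤).IsMulLeftInvariant
instance : haar.IsOpenPosMeasure := inferInstanceAs (Measure.haarMeasure ⊤).IsOpenPosMeasure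

/-- The character of `ℕ+` with value `g p` at each prime `p`. -/
def char (g : Gauge) (n : ℕ+) : Circle := (n : ℕ).factorization.prod fun p k => g p ^ k

lemma char_mul (g : Gauge) (n m : ℕ+) : g.char (n * m) = g.char n * g.char m := by
  rw [char, PNat.mul_coe, Nat.factorization_mul n.ne_zero m.ne_zero]
  exact Finsupp.prod_add_index' (fun _ => pow_zero _) fun _ _ _ => pow_add _ _ _

lemma mul_char (g g' : Gauge) (n : ℕ+) : (g * g').char n = g.char n * g'.char n := by
  simp only [char, Pi.mul_apply, mul_pow]
  exact Finsupp.prod_mul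

lemma one_char (n : ℕ+) : (1 : Gauge).char n = 1 := by simp [char]

lemma continuous_char (n : ℕ+) : Continuous fun g : Gauge => g.char n := by
  simp only [char, Finsupp.prod]
  exact continuous_finsetProd _ fun p _ => by fun_prop

/-- Put the phase exp(i) at a prime where the factorizations differ and 1 elsewhere. Distinct powers
of exp(i) differ because π is irrational. -/
lemma exists_char_ne {n m : ℕ+} (h : n ≠ m) : ∃ g : Gauge, g.char n ≠ g.char m := by
  obtain ⟨p, hp⟩ : ∃ p, (n : ℕ).factorization p ≠ (m : ℕ).factorization p := by
    by_contra! hc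
    exact h (PNat.coe_injective (Nat.eq_of_factorization_eq n.ne_zero m.ne_zero hc))
  have key : ∀ k : ℕ+, char (Pi.mulSingle p (Circle.exp 1)) k =
      Circle.exp ((k : ℕ).factorization p) := by
    intro k
    rw [char, Finsupp.prod, Finset.prod_eq_single p]
    · rw [Pi.mulSingle_eq_same, ← Circle.exp_natCast_mul, mul_one]
    · intro q _ hq
      rw [Pi.mulSingle_eq_of_ne hq, one_pow]
    · intro hpk
      rw [Finsupp.notMem_support_iff.1 hpk, pow_zero]
  refine ⟨Pi.mulSingle p (Circle.exp 1), fun he => hp ?_⟩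
  rw [key, key, Circle.exp_eq_exp] at he
  obtain ⟨q, hq⟩ := he
  by_contra hne
  have hq0 : q ≠ 0 := by
    rintro rfl
    exact hne (by simpa using hq)
  refine irrational_pi ⟨(((n : ℕ).factorization p : ℚ) - (m : ℕ).factorization p) / (2 * q), ?_⟩
  push_cast
  rw [hq]
  field_simp
  ring

end Gauge

namespace QN

open Relations MeasureTheory

/-- The scalar `χ(n) χ(m)⁻¹` by which the gauge action multiplies `uᵏ s_n s_m⋆ uˡ`. -/
def phase (g : Gauge) (n m : ℕ+) : ℂ := (g.char n : ℂ) * star (g.char m : ℂ)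

lemma coe_mul_star_coe (z : Circle) : (z : ℂ) * star (z : ℂ) = 1 := by
  rw [Complex.star_def, Complex.mul_conj, Circle.normSq_coe, Complex.ofReal_one]

lemma star_coe_mul_coe (z : Circle) : star (z : ℂ) * (z : ℂ) = 1 := by
  rw [mul_comm, coe_mul_star_coe]

lemma gauge_relations (g : Gauge) : Relations (fun n => (g.char n : ℂ) • s n) u where
  isometry n := by
    rw [star_smul, smul_mul_smul_comm, star_coe_mul_coe, one_smul, relations.isometry]
  unitary_mem := relations.unitary_mem
  mul n m := by
    rw [smul_mul_smul_comm, relations.mul, Gauge.char_mul, Circle.coe_mul]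
  mul_u n := by rw [smul_mul_assoc, relations.mul_u, mul_smul_comm]
  sum_eq_one n := by
    rw [star_smul, smul_mul_smul_comm, coe_mul_star_coe, one_smul, relations.sum_eq_one]

/-- The gauge action on `Q_ℕ`. -/
def gauge (g : Gauge) : QN →⋆ₐ[ℂ] QN := QN.lift (gauge_relations g)

lemma gauge_s (g : Gauge) (n : ℕ+) : gauge g (s n) = (g.char n : ℂ) • s n :=
  (QN.lift_mk (gauge_relations g) _).trans (freeLift_S _ _ n)

lemma gauge_u (g : Gauge) : gauge g u = u :=
  (QN.lift_mk (gauge_relations g) _).trans (freeLift_U _ _)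

lemma gauge_mono (g : Gauge) (n m : ℕ+) (k l : ℤ) :
    gauge g (relations.mono n m k l) = phase g n m • relations.mono n m k l := by
  simp only [mono, map_mul, map_star, map_uz relations relations (gauge g) (gauge_u g), gauge_s,
    star_smul, mul_smul_comm, smul_mul_assoc, smul_smul, phase, mul_comm]

lemma norm_gauge_le (g : Gauge) (x : QN) : ‖gauge g x‖ ≤ ‖x‖ :=
  NonUnitalStarAlgHom.norm_apply_le (gauge g) x

lemma gauge_one (x : QN) : gauge 1 x = x := by
  have : gauge 1 = StarAlgHom.id ℂ QN :=
    QN.hom_ext (fun n => by simp [gauge_s, Gauge.one_char]) (gauge_u 1)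
  rw [this]; rfl

lemma continuous_phase (n m : ℕ+) : Continuous fun g => phase g n m :=
  (continuous_subtype_val.comp (Gauge.continuous_char n)).mul
    (continuous_subtype_val.comp (Gauge.continuous_char m)).star

/-- Clear on monomials; it passes to limits because the gauge maps are contractive, so the
approximation is uniform in g. -/
lemma continuous_gauge (x : QN) : Continuous fun g => gauge g x := by
  refine induction_mono (P := fun x => Continuous fun g => gauge g x) ?_ ?_ ?_ ?_ ?_ x
  · refine isClosed_of_closure_subset fun x hx => ?_
    refine continuous_of_uniform_approx_of_continuous fun U hU => ?_
    obtain ⟨ε, hε, hU⟩ := Metric.mem_uniformity_dist.1 hU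
    obtain ⟨y, hy, hxy⟩ := Metric.mem_closure_iff.1 hx ε hε
    refine ⟨fun g => gauge g y, hy, fun g => hU ?_⟩
    rw [dist_eq_norm, ← map_sub]
    exact (norm_gauge_le g _).trans_lt (by rwa [← dist_eq_norm])
  · intro n m k l
    simp only [gauge_mono]
    exact (continuous_phase n m).smul continuous_const
  · simpa only [map_zero] using continuous_const
  · intro x y hx hy
    simp only [map_add]
    exact hx.add hy
  · intro c x hx
    simp only [map_smul]
    exact hx.const_smul c

lemma integrable_gauge (x : QN) : Integrable (fun g => gauge g x) Gauge.haar :=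
  (continuous_gauge x).integrable_of_hasCompactSupport (HasCompactSupport.of_compactSpace _)

/-- The conditional expectation onto the fixed point algebra of the gauge action. -/
def expect (x : QN) : QN := ∫ g, gauge g x ∂Gauge.haar

lemma expect_zero : expect 0 = 0 := by simp [expect]

lemma expect_add (x y : QN) : expect (x + y) = expect x + expect y := by
  simp only [expect, map_add]
  exact integral_add (integrable_gauge x) (integrable_gauge y)

lemma expect_smul (c : ℂ) (x : QN) : expect (c • x) = c • expect x := by
  simp only [expect, map_smul]
  exact integral_smul c _

lemma expect_neg (x : QN) : expect (-x) = -expect x := by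
  simpa using expect_smul (-1) x

lemma norm_expect_le (x : QN) : ‖expect x‖ ≤ ‖x‖ := by
  simpa [expect] using norm_integral_le_of_norm_le_const (μ := Gauge.haar) (f := fun g => gauge g x)
    (Eventually.of_forall fun g => norm_gauge_le g x)

lemma continuous_expect : Continuous expect :=
  (LipschitzWith.of_dist_le_mul (K := 1) fun x y => by
    rw [dist_eq_norm, dist_eq_norm, sub_eq_add_neg, ← expect_neg, ← expect_add, ← sub_eq_add_neg,
      NNReal.coe_one, one_mul]
    exact norm_expect_le _).continuous

/-- For n ≠ m, invariance of Haar measure shows that the average equals itself times a phase, which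
can be chosen different from 1. -/
lemma expect_mono (n m : ℕ+) (k l : ℤ) :
    expect (relations.mono n m k l) = if n = m then relations.mono n m k l else 0 := by
  split_ifs with h
  · subst h
    simp only [expect, gauge_mono, phase, coe_mul_star_coe, one_smul]
    simp
  · obtain ⟨g₀, hg₀⟩ := Gauge.exists_char_ne h
    have h1 : expect (relations.mono n m k l) =
        phase g₀ n m • expect (relations.mono n m k l) := by
      rw [expect, ← integral_smul]
      conv_lhs => rw [← integral_mul_left_eq_self (μ := Gauge.haar) _ g₀]
      refine integral_congr_ae (Eventually.of_forall fun g => ?_)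
      simp only [gauge_mono, smul_smul, phase, Gauge.mul_char, Circle.coe_mul, star_mul']
      congr 1; ring
    have h2 : (1 - phase g₀ n m) • expect (relations.mono n m k l) = 0 := by
      rw [sub_smul, one_smul, ← h1, sub_self]
    refine (smul_eq_zero.1 h2).resolve_left fun h3 => hg₀ (Circle.ext ?_)
    calc (g₀.char n : ℂ) = phase g₀ n m * g₀.char m := by
          rw [phase, mul_assoc, star_coe_mul_coe, mul_one]
      _ = _ := by rw [← sub_eq_zero.1 h3, one_mul]

lemma expect_mem_closure (x : QN) : expect x ∈ relations.fixSpan.topologicalClosure := by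
  refine induction_mono (P := fun x => expect x ∈ relations.fixSpan.topologicalClosure)
    ?_ ?_ ?_ ?_ ?_ x
  · exact (Submodule.isClosed_topologicalClosure _).preimage continuous_expect
  · intro n m k l
    rw [expect_mono]
    split_ifs with h
    · subst h
      exact Submodule.le_topologicalClosure _ (relations.mono_mem_fixSpan n k l)
    · exact zero_mem _
  · rw [expect_zero]; exact zero_mem _
  · intro x y hx hy
    rw [expect_add]; exact add_mem hx hy
  · intro c x hx
    rw [expect_smul]; exact Submodule.smul_mem _ c hx

lemma gauge_star_mul_self_nonneg (g : Gauge) (b : QN) : 0 ≤ gauge g (star b * b) := by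
  rw [map_mul, map_star]; exact star_mul_self_nonneg _

lemma expect_star_mul_self_nonneg (b : QN) : 0 ≤ expect (star b * b) :=
  integral_nonneg fun g => gauge_star_mul_self_nonneg g b

/-- The conditional expectation is faithful. -/
lemma eq_zero_of_expect_eq_zero {b : QN} (hb : expect (star b * b) = 0) : star b * b = 0 := by
  by_contra hx
  set x := star b * b with hx_def
  have hpos : 0 < ‖x‖ := norm_pos_iff.2 hx
  -- A neighbourhood of 1, so of positive measure μ. By positivity the integral over V vanishes, yet
  -- it lies within μ‖x‖/2 of μ·x.
  set V : Set Gauge := {g | ‖gauge g x - x‖ < ‖x‖ / 2} with hV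
  have hVo : IsOpen V := isOpen_lt ((continuous_gauge x).sub continuous_const).norm continuous_const
  have hV1 : (1 : Gauge) ∈ V := by
    rw [hV, Set.mem_ofPred_eq, gauge_one, sub_self, norm_zero]; positivity
  have hμ : 0 < Gauge.haar.real V :=
    ENNReal.toReal_pos (hVo.measure_pos _ ⟨1, hV1⟩).ne' (measure_ne_top _ _)
  have h1 : ∫ g in V, gauge g x ∂Gauge.haar = 0 := by
    have hs := integral_add_compl hVo.measurableSet (integrable_gauge x)
    rw [show ∫ g, gauge g x ∂Gauge.haar = 0 from hb] at hs
    exact (add_eq_zero_iff_of_nonneg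
      (integral_nonneg fun g => gauge_star_mul_self_nonneg g b)
      (integral_nonneg fun g => gauge_star_mul_self_nonneg g b)).1 hs |>.1
  have h2 : ‖∫ g in V, (gauge g x - x) ∂Gauge.haar‖ ≤ ‖x‖ / 2 * Gauge.haar.real V :=
    norm_setIntegral_le_of_norm_le_const (measure_lt_top _ _) fun g hg => le_of_lt hg
  rw [integral_sub (integrable_gauge x).integrableOn (integrable_const x).integrableOn, h1,
    setIntegral_const, zero_sub, norm_neg, norm_smul, Real.norm_of_nonneg hμ.le] at h2
  nlinarith

end QN

/-! ## Simplicity and pure infiniteness -/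

lemma L2Z.relations_uz (k : ℤ) : L2Z.relations.uz k = L2Z.T k := by
  obtain ⟨k, rfl | rfl⟩ := k.eq_nat_or_neg
  · rw [Relations.uz_natCast, L2Z.T_pow]
  · rw [← Relations.star_uz, Relations.uz_natCast, L2Z.T_pow, L2Z.star_T]

namespace QN

open Relations

lemma rep_mono (n m : ℕ+) (k l : ℤ) :
    rep (relations.mono n m k l) = L2Z.T k * L2Z.S n * star (L2Z.S m) * L2Z.T l := by
  simp only [mono, map_mul, map_star, map_uz relations L2Z.relations rep rep_u, rep_s,
    L2Z.relations_uz]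

/-- The vector state of the conditional expectation at a basis vector. -/
def diag (i : ℤ) (x : QN) : ℂ := inner ℂ (L2Z.e i) (rep (expect x) (L2Z.e i))

lemma diag_add (i : ℤ) (x y : QN) : diag i (x + y) = diag i x + diag i y := by
  simp only [diag, expect_add, map_add, add_apply, inner_add_right]

lemma diag_smul (i : ℤ) (c : ℂ) (x : QN) : diag i (c • x) = c * diag i x := by
  simp only [diag, expect_smul, map_smul, smul_apply, inner_smul_right]

lemma diag_sub (i : ℤ) (x y : QN) : diag i (x - y) = diag i x - diag i y := by
  rw [sub_eq_add_neg, ← neg_one_smul ℂ y, diag_add, diag_smul]; ring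

lemma norm_diag_le (i : ℤ) (x : QN) : ‖diag i x‖ ≤ ‖x‖ := by
  have he : ‖L2Z.e i‖ = 1 := L2Z.orthonormal_e.1 i
  calc ‖diag i x‖ ≤ ‖L2Z.e i‖ * ‖rep (expect x) (L2Z.e i)‖ := norm_inner_le_norm _ _
    _ ≤ ‖rep (expect x)‖ := by
      simpa [he] using (rep (expect x)).le_opNorm (L2Z.e i)
    _ ≤ ‖expect x‖ := NonUnitalStarAlgHom.norm_apply_le rep _
    _ ≤ ‖x‖ := norm_expect_le x

/-- The same scalar as in `eventually_iso_compress_mono`; this agreement identifies the limit of the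
compressions. -/
lemma diag_mono (i : ℤ) (n m : ℕ+) (k l : ℤ) : diag i (relations.mono n m k l) =
    if n = m ∧ k + l = 0 ∧ (n : ℤ) ∣ i + l then 1 else 0 := by
  rw [diag, expect_mono]
  by_cases h : n = m
  · subst h
    rw [if_pos rfl, rep_mono, mul_assoc (L2Z.T k), mul_apply_eq_comp, mul_apply_eq_comp, L2Z.T_e,
      L2Z.range_projection_e]
    by_cases hd : (n : ℤ) ∣ i + l
    · rw [if_pos hd, L2Z.T_e, L2Z.inner_e_e]
      refine if_congr ⟨fun h' => ⟨rfl, by omega, hd⟩, fun h' => by omega⟩ rfl rfl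
    · rw [if_neg hd, map_zero, inner_zero_right, if_neg fun h' => hd h'.2.2]
  · rw [if_neg h, if_neg fun h' => h h'.1, map_zero]
    simp

lemma norm_compress_le (i : ℤ) (t : ℕ) (x : QN) :
    ‖star (relations.iso i t) * x * relations.iso i t‖ ≤ ‖x‖ := by
  have h1 : ‖relations.iso i t‖ ≤ 1 := by
    have := CStarRing.norm_star_mul_self (x := relations.iso i t)
    rw [star_iso_mul_iso, CStarRing.norm_one] at this
    nlinarith [norm_nonneg (relations.iso i t)]
  calc _ ≤ ‖star (relations.iso i t)‖ * ‖x‖ * ‖relations.iso i t‖ :=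
        (norm_mul_le _ _).trans (mul_le_mul_of_nonneg_right (norm_mul_le _ _) (norm_nonneg _))
    _ ≤ 1 * ‖x‖ * 1 := by rw [norm_star]; gcongr
    _ = ‖x‖ := by ring

/-- Compression by the isometries `iso i t` converges to the scalar `diag i x`. -/
lemma tendsto_compress (i : ℤ) (x : QN) :
    Tendsto (fun t => star (relations.iso i t) * x * relations.iso i t) atTop
      (𝓝 (diag i x • 1)) := by
  refine induction_mono (P := fun x => Tendsto
    (fun t => star (relations.iso i t) * x * relations.iso i t) atTop (𝓝 (diag i x • 1)))
    ?_ ?_ ?_ ?_ ?_ x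
  · refine isClosed_of_closure_subset fun x hx => Metric.tendsto_nhds.2 fun ε hε => ?_
    obtain ⟨y, hy, hxy⟩ := Metric.mem_closure_iff.1 hx (ε / 3) (by positivity)
    filter_upwards [Metric.tendsto_nhds.1 hy (ε / 3) (by positivity)] with t ht
    have h1 := norm_compress_le i t (x - y)
    have h2 : ‖(diag i y - diag i x) • (1 : QN)‖ ≤ ‖x - y‖ := by
      rw [norm_smul, CStarRing.norm_one, mul_one, norm_sub_rev, ← diag_sub]
      exact norm_diag_le i _
    rw [dist_eq_norm] at ht hxy ⊢
    calc _ = ‖star (relations.iso i t) * (x - y) * relations.iso i t +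
          (star (relations.iso i t) * y * relations.iso i t - diag i y • 1) +
          (diag i y - diag i x) • (1 : QN)‖ := by
          congr 1; rw [mul_sub, sub_mul, sub_smul]; abel
      _ ≤ _ := norm_add₃_le
      _ < ε := by linarith
  · intro n m k l
    rw [diag_mono]
    exact tendsto_const_nhds.congr'
      ((relations.eventually_iso_compress_mono i n m k l).mono fun t ht => ht.symm)
  · have : diag i 0 = 0 := by simpa using diag_smul i 0 0
    simp [this]
  · intro x y hx hy
    simpa only [mul_add, add_mul, diag_add, add_smul] using hx.add hy
  · intro c x hx
    simpa only [mul_smul_comm, smul_mul_assoc, diag_smul, mul_smul] using hx.const_smul c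

lemma exists_isUnit_compress {b : QN} (hb : b ≠ 0) :
    ∃ v : QN, IsUnit (star v * (star b * b) * v) := by
  have hx : star b * b ≠ 0 := fun h => hb (CStarRing.star_mul_self_eq_zero_iff b |>.1 h)
  have hz : expect (star b * b) ≠ 0 := fun h => hx (eq_zero_of_expect_eq_zero h)
  -- With E(b⋆b) = c⋆c the i-th diagonal entry is the squared norm of `rep c (e i)`, so these
  -- entries cannot all vanish.
  obtain ⟨c, hc⟩ := CStarAlgebra.nonneg_iff_eq_star_mul_self.1 (expect_star_mul_self_nonneg b)
  have hrep : rep (expect (star b * b)) ≠ 0 := by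
    rw [← norm_ne_zero_iff, norm_rep_of_mem_closure (expect_mem_closure _), norm_ne_zero_iff]
    exact hz
  obtain ⟨i, hi⟩ : ∃ i, rep c (L2Z.e i) ≠ 0 := by
    by_contra! h
    have h0 : rep c = 0 := L2Z.ext_op fun i => by rw [h i, zero_apply]
    exact hrep (by rw [hc, map_mul, h0, mul_zero])
  have hd : diag i (star b * b) ≠ 0 := by
    rw [diag, hc, map_mul, map_star, mul_apply_eq_comp, ContinuousLinearMap.star_eq_adjoint,
      ContinuousLinearMap.adjoint_inner_right]
    exact inner_self_ne_zero.2 hi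
  have hu : IsUnit (diag i (star b * b) • (1 : QN)) := by
    rw [← Algebra.algebraMap_eq_smul_one]
    exact (isUnit_iff_ne_zero.2 hd).map (algebraMap ℂ QN)
  -- Invertible elements form an open set, so a compression close to the nonzero scalar is
  -- invertible.
  obtain ⟨t, ht⟩ := ((tendsto_compress i (star b * b)).eventually
    (Units.isOpen.mem_nhds hu)).exists
  exact ⟨_, ht⟩

/-- Polar normalization: if h = (bv)⋆(bv) is invertible, then b v h^(-1/2) is an isometry. -/
lemma exists_isometry {b : QN} (hb : b ≠ 0) : ∃ a : QN, star (b * a) * (b * a) = 1 := by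
  obtain ⟨v, hv⟩ := exists_isUnit_compress hb
  set h : QN := star v * (star b * b) * v with hh
  have h0 : 0 ≤ h := by
    have : h = star (b * v) * (b * v) := by rw [hh, star_mul]; simp only [mul_assoc]
    rw [this]; exact star_mul_self_nonneg _
  have hsa : star (h ^ (-(1 / 2) : ℝ)) = h ^ (-(1 / 2) : ℝ) :=
    (IsSelfAdjoint.of_nonneg CFC.rpow_nonneg).star_eq
  refine ⟨v * h ^ (-(1 / 2) : ℝ), ?_⟩
  calc _ = h ^ (-(1 / 2) : ℝ) * h * h ^ (-(1 / 2) : ℝ) := by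
        rw [star_mul, star_mul, hsa, hh]; simp only [mul_assoc]
    _ = h ^ (-(1 / 2) : ℝ) * h ^ (1 : ℝ) * h ^ (-(1 / 2) : ℝ) := by rw [CFC.rpow_one h]
    _ = 1 := by
      rw [← CFC.rpow_add hv, ← CFC.rpow_add hv]
      norm_num
      exact CFC.rpow_zero h

theorem isSimple : IsSimpleCStar QN := by
  refine ⟨inferInstance, fun I _ => or_iff_not_imp_left.2 fun hI => ?_⟩
  obtain ⟨b, hb, hb0⟩ : ∃ b ∈ I, b ≠ 0 := by
    by_contra! h
    exact hI (eq_bot_iff.2 fun x hx => (TwoSidedIdeal.mem_bot QN).2 (h x hx))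
  obtain ⟨a, ha⟩ := exists_isometry hb0
  rw [eq_top_iff]
  intro x _
  have h1 : (1 : QN) ∈ I := ha ▸ I.mul_mem_left _ _ (I.mul_mem_right _ _ hb)
  simpa using I.mul_mem_left x 1 h1

/-- `s₂` is a proper isometry. -/
lemma s_two_mul_star_ne_one : s 2 * star (s 2) ≠ 1 := by
  intro h
  have h1 := relations.sum_eq_one 2
  have hu := (Unitary.mem_iff.1 relations.unitary_mem).2
  -- The sum relation for n = 2 would now read 1 + uu⋆ = 1, that is 1 + 1 = 1.
  rw [h] at h1
  simp only [PNat.val_ofNat, Finset.sum_range_succ, Finset.sum_range_zero, pow_zero, pow_one,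
    mul_one, zero_add, hu] at h1
  simp at h1

/-- For the isometry v = ba, vv⋆ = b(aa⋆)b⋆ is dominated by a multiple of bb⋆, so heredity puts it
in B. Conjugation by v carries the proper isometry s₂ to the corner of vv⋆. -/
theorem isPurelyInfinite : IsPurelyInfinite QN := by
  intro B hB hne
  obtain ⟨b, hb, hb0⟩ : ∃ b ∈ B, b ≠ 0 := by
    by_contra! h
    exact hne (eq_bot_iff.2 fun x hx => by
      rw [h x hx]; exact zero_mem _)
  obtain ⟨a, ha⟩ := exists_isometry hb0
  set v := b * a with hv
  have hvv : ∀ x, star v * (v * x) = x := fun x => by rw [← mul_assoc, ha, one_mul]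
  have hss : ∀ x, star (s 2) * (s 2 * x) = x := fun x => by
    rw [← mul_assoc, relations.isometry, one_mul]
  have hle : v * star v ≤ ‖a * star a‖ • (b * star b) := by
    have := CStarAlgebra.star_right_conjugate_le_norm_smul (a := b) (b := a * star a)
      (IsSelfAdjoint.mul_star_self a)
    simpa only [hv, star_mul, mul_assoc] using this
  have hmem : ‖a * star a‖ • (b * star b) ∈ B := by
    have := SMulMemClass.smul_mem (‖a * star a‖ : ℂ) (mul_mem hb (star_mem hb))
    rwa [Complex.coe_smul] at this
  refine ⟨v * star v, hB.mem_of_le _ _ (mul_star_self_nonneg v) hle hmem, ⟨?_, ?_⟩,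
    v * s 2 * star v, ?_, ?_, ?_⟩
  · change v * star v * (v * star v) = v * star v
    simp only [mul_assoc, hvv]
  · exact IsSelfAdjoint.mul_star_self v
  · simp only [star_mul, star_star, mul_assoc, hvv, hss]
  · have h2 : s 2 * star (s 2) ≤ 1 := by
      rw [← sub_nonneg]
      have : 1 - s 2 * star (s 2) =
          star (1 - s 2 * star (s 2)) * (1 - s 2 * star (s 2)) := by
        simp only [star_sub, star_one, star_mul, star_star, mul_sub, sub_mul, mul_one, one_mul,
          mul_assoc, hss]
        abel
      rw [this]; exact star_mul_self_nonneg _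
    have := star_right_conjugate_le_conjugate h2 v
    simpa only [star_mul, star_star, mul_assoc, hvv, mul_one] using this
  · intro h
    refine s_two_mul_star_ne_one ?_
    -- Compressing by v undoes the conjugation and would give s₂s₂⋆ = 1.
    have := congrArg (fun x => star v * x * v) h
    simpa only [star_mul, star_star, mul_assoc, hvv, ha, mul_one] using this

end QN

end QNat

end

theorem mainTheorem1 :
    QNat.IsUniversal QNat.QN QNat.QN.s QNat.QN.u ∧
      QNat.IsSimpleCStar QNat.QN ∧ QNat.IsPurelyInfinite QNat.QN :=
  ⟨QNat.QN.isUniversal, QNat.QN.isSimple, QNat.QN.isPurelyInfinite⟩
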